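/- Let $\mathcal U,\mathcal V,\mathcal X,\mathcal Y$ be finite alphabets, $P_{UV}$ a probability distribution on $\mathcal U\times\mathcal V$ with $H(U|V)>0$, $W=\{W(y|x)\}$ a discrete memoryless channel from $\mathcal X$ to $\mathcal Y$, $Q$ a probability distribution on $\mathcal X$, and $R>0$. All logarithms are to the base $2$, $a\wedge b=\min\{a,b\}$ and $[a]_+=\max\{0,a\}$. *System.* For block length $n$, let $(\mathbf U,\mathbf V)$ be $n$ independent copies of $(U,V)\sim P_{UV}$. Each $\mathbf u\in\mathcal U^n$ is independently assigned a bin $f(\mathbf u)$, uniform over $M=\lceil 2^{nR}\rceil$ bins. Independently of $f$, codewords $\mathbf x(1),\dots,\mathbf x(M)$ are drawn independently and uniformly from the type class $\mathcal T(Q_n)\subseteq\mathcal X^n$ of all sequences with empirical distribution $Q_n$. Here $n$ runs through any sequence of block lengths tending to infinity, and the $Q_n$ are any distributions with $\mathcal T(Q_n)\neq\emptyset$ and $Q_n\to Q$ (in particular $Q_n=Q$ along block lengths for which $\mathcal T(Q)\ne\emptyset$). The source vector $\mathbf u$ is transmitted as $\mathbf x[\mathbf u]=\mathbf x(f(\mathbf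 u))$ over the channel, so that the output $\mathbf y\in\mathcal Y^n$ has probability $W(\mathbf y|\mathbf x)=\prod_t W(y_t|x_t)$ given $\mathbf x=\mathbf x[\mathbf u]$. A decoder knows $f$ and the codewords and estimates $\mathbf u$ by $\hat{\mathbf u}$ from $\mathbf y$ and the side information $\mathbf v$. Its average error probability $\overline{P_e}$ is the probability of $\hat{\mathbf U}\ne\mathbf U$ under all the randomness, that of $f$ and of the codewords included. Its exponent is $\lim_{n\to\infty}\bigl[-\tfrac1n\log\overline{P_e}\bigr]$. Hats denote information measures of the joint empirical distributions of the indicated sequences. **Theorem 1.** Let $$E(R,Q)=\min_{P_{U'V'},\,W'}\Bigl\{D(P_{U'V'}\|P_{UV})+D(W'\|W|Q)+\bigl[R\wedge I(X;Y')-H(U'|V')\bigr]_+\Bigr\},$$ where the minimum is over all distributions $P_{U'V'}$ of $(U',V')$ on $\mathcal U\times\mathcal V$ and all channels $W'$ from $\mathcal X$ to $\mathcal Y$, $Y'$ is the output of $W'$ when its input is $X\sim Q$, $D(\cdot\|\cdot)\in[0,\infty]$ is the Kullback–Leibler divergence, and $D(W'\|W|Q)=\sum_x Q(x)D(W'(\cdot|x)\|W(\cdot|x))$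 with $0\cdot\infty=0$. The minimum is attained and finite, and the following holds, for every rule of breaking ties in the maxima. (a) The exponent of the MAP decoder $\hat{\mathbf u}=\arg\max_{\mathbf u}P(\mathbf u,\mathbf v)W(\mathbf y|\mathbf x[\mathbf u])$, where $P(\mathbf u,\mathbf v)=\prod_t P_{UV}(u_t,v_t)$, exists and equals $E(R,Q)$. (b) The exponents of the universal decoders $$\hat{\mathbf u}=\arg\max_{\mathbf u}\bigl[\hat I_{\mathbf x[\mathbf u]\mathbf y}(X;Y)-\hat H_{\mathbf u\mathbf v}(U|V)\bigr]\quad\text{and}\quad \hat{\mathbf u}=\arg\max_{\mathbf u}\bigl[R\wedge\hat I_{\mathbf x[\mathbf u]\mathbf y}(X;Y)-\hat H_{\mathbf u\mathbf v}(U|V)\bigr]$$ both exist and equal $E(R,Q)$ as well. -/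

import Mathlib

open Filter Topology

noncomputable section

namespace BinningExponent

/-! ### Information measures on finite alphabets (logarithms to the base 2) -/

/-- Shannon entropy `-∑ p(a) log p(a)`. -/
def entropy {A : Type*} [Fintype A] (p : A → ℝ) : ℝ :=
  -∑ a, p a * Real.logb 2 (p a)

/-- First marginal of a joint distribution. -/
def margFst {A B : Type*} [Fintype B] (p : A × B → ℝ) (a : A) : ℝ := ∑ b, p (a, b)

/-- Second marginal of a joint distribution. -/
def margSnd {A B : Type*} [Fintype A] (p : A × B → ℝ) (b : B) : ℝ := ∑ a, p (a, b)

/-- `H(A|B) = H(A,B) - H(B)`. -/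
def condEntropy {A B : Type*} [Fintype A] [Fintype B] (p : A × B → ℝ) : ℝ :=
  entropy p - entropy (margSnd p)

/-- `I(A;B) = H(A) + H(B) - H(A,B)`. -/
def mutualInfo {A B : Type*} [Fintype A] [Fintype B] (p : A × B → ℝ) : ℝ :=
  entropy (margFst p) + entropy (margSnd p) - entropy p

open Classical in
/-- Kullback–Leibler divergence `D(p‖q)`; it is `+∞` unless `p` vanishes wherever `q` does. -/
def relEntropy {A : Type*} [Fintype A] (p q : A → ℝ) : EReal :=
  if ∀ a, q a = 0 → p a = 0 then
    ((∑ a, p a * Real.logb 2 (p a / q a) : ℝ) : EReal)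
  else ⊤

/-- `D(W'‖W|Q) = ∑ₓ Q(x) D(W'(·|x)‖W(·|x))`, with `0 · ∞ = 0`. -/
def condRelEntropy {X Y : Type*} [Fintype X] [Fintype Y] (W' W : X → Y → ℝ) (Q : X → ℝ) : EReal :=
  ∑ x, (Q x : EReal) * relEntropy (W' x) (W x)

/-- The joint distribution of input and output of the channel `W` with input law `Q`. -/
def joint {X Y : Type*} (Q : X → ℝ) (W : X → Y → ℝ) : X × Y → ℝ :=
  fun xy => Q xy.1 * W xy.1 xy.2

/-- The functional
`D(P_{U'V'}‖P_{UV}) + D(W'‖W|Q) + [R ∧ I(X;Y') - H(U'|V')]₊` of `(P', W')`. -/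
def exponentObjective {U V X Y : Type*} [Fintype U] [Fintype V] [Fintype X] [Fintype Y]
    (P : U × V → ℝ) (W : X → Y → ℝ) (Q : X → ℝ) (R : ℝ)
    (P' : U × V → ℝ) (W' : X → Y → ℝ) : EReal :=
  relEntropy P' P + condRelEntropy W' W Q +
    ((max 0 (min R (mutualInfo (joint Q W')) - condEntropy P') : ℝ) : EReal)

/-- The values of the functional over all distributions `P'` on `U × V` and channels `W'`. -/
def exponentValues {U V X Y : Type*} [Fintype U] [Fintype V] [Fintype X] [Fintype Y]
    (P : U × V → ℝ) (W : X → Y → ℝ) (Q : X → ℝ) (R : ℝ) : Set EReal :=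
  {e | ∃ P' ∈ stdSimplex ℝ (U × V), ∃ W' : X → Y → ℝ,
    (∀ x, W' x ∈ stdSimplex ℝ Y) ∧ e = exponentObjective P W Q R P' W'}

/-! ### Empirical distributions and type classes -/

/-- The empirical distribution of a sequence of length `n`. -/
def empDist {A : Type*} [DecidableEq A] {n : ℕ} (x : Fin n → A) (a : A) : ℝ :=
  ((Finset.univ.filter fun i => x i = a).card : ℝ) / n

/-- The joint empirical distribution of two sequences of length `n`. -/
def empJoint {A B : Type*} [DecidableEq A] [DecidableEq B] {n : ℕ}
    (x : Fin n → A) (y : Fin n → B) : A × B → ℝ :=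
  empDist fun i => (x i, y i)

/-- The type class of `Q`: all sequences of length `n` with empirical distribution `Q`. It is empty
when `Q` is not a type of denominator `n`. -/
def typeClass {X : Type*} [Fintype X] [DecidableEq X] (n : ℕ) (Q : X → ℝ) :
    Finset (Fin n → X) :=
  Finset.univ.filter fun x => empDist x = Q

/-! ### The communication system -/

/-- The number of bins, `2^{nR}` rounded up to an integer. -/
def numBins (R : ℝ) (n : ℕ) : ℕ := ⌈(2 : ℝ) ^ ((n : ℝ) * R)⌉₊

/-- A binning code: it assigns a bin to every source vector. -/
abbrev Binning (U : Type*) (n M : ℕ) := (Fin n → U) → Fin M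

/-- A channel code: it assigns to every bin a codeword from the type class of `Q`. -/
abbrev Codebook {X : Type*} [Fintype X] [DecidableEq X] (n M : ℕ) (Q : X → ℝ) :=
  Fin M → ↥(typeClass n Q)

/-- A decoder knows the binning code and the channel code, and estimates the source vector from
the side information and the channel output. -/
abbrev Decoder (U V Y : Type*) {X : Type*} [Fintype X] [DecidableEq X] (n M : ℕ) (Q : X → ℝ) :=
  Binning U n M → Codebook n M Q → (Fin n → V) → (Fin n → Y) → (Fin n → U)

/-- `δ` is an arg-max decoder for a decoding metric `m(u, v, x, y)`, with any rule for breaking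
ties: its decision maximizes `m(u, v, x[u], y)` over all source vectors `u`, where `x[u]` is the
codeword of the bin of `u`. -/
def IsArgmaxDecoder {U V X Y : Type*} [Fintype X] [DecidableEq X] {n M : ℕ} {Q : X → ℝ}
    (m : (Fin n → U) → (Fin n → V) → (Fin n → X) → (Fin n → Y) → ℝ)
    (δ : Decoder U V Y n M Q) : Prop :=
  ∀ (f : Binning U n M) (C : Codebook n M Q) (v : Fin n → V) (y : Fin n → Y) (u : Fin n → U),
    m u v (C (f u)) y ≤ m (δ f C v y) v (C (f (δ f C v y))) y

/-- The average probability of the event that the decision differs from the source vector. The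
binning code and the channel code are uniform and independent, the source and its side information
are memoryless with law `P`, and the channel is memoryless with transition probabilities `W`. -/
def errorProb {U V X Y : Type*} [Fintype U] [Fintype V] [Fintype X] [Fintype Y]
    [DecidableEq U] [DecidableEq X] {n M : ℕ} {Q : X → ℝ}
    (P : U × V → ℝ) (W : X → Y → ℝ) (δ : Decoder U V Y n M Q) : ℝ :=
  (∑ f : Binning U n M, ∑ C : Codebook n M Q,
    ∑ u : Fin n → U, ∑ v : Fin n → V, ∑ y : Fin n → Y,
      if δ f C v y ≠ u then
        (∏ i, P (u i, v i)) * ∏ i, W ((C (f u)).1 i) (y i)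
      else 0) /
  ((Fintype.card (Binning U n M) : ℝ) * Fintype.card (Codebook n M Q))

/-- The metric of the MAP decoder, `P(u, v) W(y|x)`. -/
def mapMetric {U V X Y : Type*} {n : ℕ} (P : U × V → ℝ) (W : X → Y → ℝ)
    (u : Fin n → U) (v : Fin n → V) (x : Fin n → X) (y : Fin n → Y) : ℝ :=
  (∏ i, P (u i, v i)) * ∏ i, W (x i) (y i)

/-- The generalized MMI metric, `Î(X;Y) - Ĥ(U|V)`. -/
def gmmiMetric {U V X Y : Type*} [Fintype U] [Fintype V] [Fintype X] [Fintype Y]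
    [DecidableEq U] [DecidableEq V] [DecidableEq X] [DecidableEq Y] {n : ℕ}
    (u : Fin n → U) (v : Fin n → V) (x : Fin n → X) (y : Fin n → Y) : ℝ :=
  mutualInfo (empJoint x y) - condEntropy (empJoint u v)

/-- The variant metric, `R ∧ Î(X;Y) - Ĥ(U|V)`. -/
def gmmiMetric' {U V X Y : Type*} [Fintype U] [Fintype V] [Fintype X] [Fintype Y]
    [DecidableEq U] [DecidableEq V] [DecidableEq X] [DecidableEq Y] {n : ℕ} (R : ℝ)
    (u : Fin n → U) (v : Fin n → V) (x : Fin n → X) (y : Fin n → Y) : ℝ :=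
  min R (mutualInfo (empJoint x y)) - condEntropy (empJoint u v)

/-- The probabilities `p k` at block lengths `n k` have the exponent `E`: they are eventually
positive (so that the logarithm is meaningful) and `-(1/n) log p → E`. -/
def HasExponent (n : ℕ → ℕ) (p : ℕ → ℝ) (E : ℝ) : Prop :=
  (∀ᶠ k in atTop, 0 < p k) ∧
    Tendsto (fun k => -Real.logb 2 (p k) / (n k : ℝ)) atTop (𝓝 E)

end BinningExponent

end

noncomputable section

namespace BinningExponent

/-! ### Empirical distributions -/

/-! The proof is the method of types, with all polynomial losses recorded as powers of `3 * (n +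
1)`. The inputs are $|T(p)| \doteq 2^{nH(p)}$ (`card_typeClass_le`, `le_card_typeClass`), the
polynomial number of types (`card_image_empDist_le`), and the equal size of all fibres of $T(p)$
over its marginal class (`card_fiber_mul_card_typeClass`). For a joint distribution $J$ of input and
output with first marginal $Q$, `jointObjective` is the functional to be minimized.

Upper bound. Fix $u, v, y$ and the codeword $x_0$ of $u$, and put $c = R \wedge \hat I(x_0;y) - \hat
H(u|v)$. An error needs some $u' \ne u$ whose metric is at least that of $u$. If $u'$ lies in
another bin its codeword is independent of $x_0$; if it lies in the same bin, an event of
probability $1/M$, only the source part of the metric matters. For metrics satisfying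
`IsUniversalMetric` both cases together give a union bound of order $2^{-nc}$
(`sum_competitors_le`). Truncating it at $1$ turns $c$ into $[c]_+$. Multiplying by
$P(u,v)W(y|x_0)/|T(Q)|$ and summing type by type gives `errorProb_le`. The MAP decoder inherits the
bound because no decoder has a smaller error probability (`errorProb_map_le`).

Lower bound, for every decoder. Fix joint types $p$ and $J$. For given $v, y$, all words $u$ of
joint type $p$ with $v$ whose codewords have joint type $J$ with $y$ have the same value of
$P(u,v)W(y|x)$, and at most one of them is decoded correctly, so at least half of two or more are
lost (`le_sum_errors`). A second moment argument shows that a given such word has a companion with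
conditional probability at least of order $\min(1, 2^{n(H(p_{U|V}) - R \wedge I(J))})$
(`le_expect_exists_code`, `le_card_competitors`, `le_collision_prob`), which yields `le_errorProb`.
This needs at least two words per conditional type class. Hence the minimizer is perturbed towards
$P$ to have positive conditional entropy (`exists_condEntropy_pos`), which is where $H(U|V) > 0$
enters.

Limits. The minimum exists by compactness and continuity. As $Q_n \to Q$, the upper bound uses lower
semicontinuity of the minimum (`eventually_le_jointObjective`), and the lower bound uses joint types
that approximate the perturbed minimizer with input marginal exactly $Q_n$
(`exists_joint_type_near`). -/

theorem sum_prod_apply {A : Type*} [Fintype A] {n : ℕ} (g : A → ℝ) :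
    ∑ x : Fin n → A, ∏ i, g (x i) = (∑ a, g a) ^ n := by
  rw [← Fintype.piFinset_univ, Finset.sum_prod_piFinset]
  simp

section Types

variable {A B : Type*} [DecidableEq A] [DecidableEq B] {n : ℕ}

theorem empDist_nonneg (x : Fin n → A) (a : A) : 0 ≤ empDist x a := by
  unfold empDist; positivity

theorem natCast_mul_empDist (hn : 0 < n) (x : Fin n → A) (a : A) :
    (n : ℝ) * empDist x a = ((Finset.univ.filter fun i => x i = a).card : ℝ) := by
  unfold empDist
  field_simp

theorem sum_empDist_mul [Fintype A] (hn : 0 < n) (x : Fin n → A) (g : A → ℝ) :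
    (n : ℝ) * ∑ a, empDist x a * g a = ∑ i, g (x i) := by
  rw [Finset.mul_sum, ← Finset.sum_fiberwise Finset.univ x]
  refine Finset.sum_congr rfl fun a _ => ?_
  rw [← mul_assoc, natCast_mul_empDist hn,
    Finset.sum_congr rfl (g := fun _ => g a) (fun i hi => by rw [(Finset.mem_filter.1 hi).2])]
  simp

theorem empDist_mem_stdSimplex [Fintype A] (hn : 0 < n) (x : Fin n → A) :
    empDist x ∈ stdSimplex ℝ A := by
  refine ⟨empDist_nonneg x, ?_⟩
  have h := sum_empDist_mul hn x fun _ => 1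
  have hn' : (n : ℝ) ≠ 0 := by positivity
  simp only [mul_one, Finset.sum_const, Finset.card_univ, Fintype.card_fin, nsmul_eq_mul] at h
  exact mul_left_cancel₀ hn' (by rw [h, mul_one])

theorem empDist_apply_pos (x : Fin n → A) (i : Fin n) : 0 < empDist x (x i) := by
  unfold empDist
  have : 0 < (Finset.univ.filter fun j => x j = x i).card :=
    Finset.card_pos.2 ⟨i, by simp⟩
  have hn : 0 < n := i.pos
  positivity

theorem margFst_empJoint [Fintype B] (x : Fin n → A) (y : Fin n → B) :
    margFst (empJoint x y) = empDist x := by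
  funext a
  unfold margFst empJoint empDist
  rw [← Finset.sum_div, ← Nat.cast_sum]
  congr 2
  rw [Finset.card_eq_sum_card_fiberwise (f := y) (t := Finset.univ) (by simp)]
  refine Finset.sum_congr rfl fun b _ => ?_
  rw [Finset.filter_filter]
  simp [Prod.ext_iff]

theorem margSnd_empJoint [Fintype A] (x : Fin n → A) (y : Fin n → B) :
    margSnd (empJoint x y) = empDist y := by
  funext b
  unfold margSnd empJoint empDist
  rw [← Finset.sum_div, ← Nat.cast_sum]
  congr 2
  rw [Finset.card_eq_sum_card_fiberwise (f := x) (t := Finset.univ) (by simp)]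
  refine Finset.sum_congr rfl fun a _ => ?_
  rw [Finset.filter_filter]
  simp [Prod.ext_iff, and_comm]

theorem empDist_comp_perm (x : Fin n → A) (σ : Equiv.Perm (Fin n)) :
    empDist (x ∘ σ) = empDist x := by
  funext a
  unfold empDist
  congr 2
  exact Finset.card_equiv σ (by simp)

theorem card_filter_eq_of_empDist_eq {x y : Fin n → A} (h : empDist x = empDist y) (a : A) :
    (Finset.univ.filter fun i => x i = a).card = (Finset.univ.filter fun i => y i = a).card := by
  rcases Nat.eq_zero_or_pos n with rfl | hn
  · simp
  · have := congrFun h a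
    have h1 := natCast_mul_empDist hn x a
    rw [this, natCast_mul_empDist hn] at h1
    exact_mod_cast h1.symm

/-- Two sequences with the same empirical distribution are permutations of each other. -/
theorem exists_perm_of_empDist_eq {x y : Fin n → A} (h : empDist x = empDist y) :
    ∃ σ : Equiv.Perm (Fin n), y ∘ σ = x := by
  have e : ∀ a, Nonempty ({i // x i = a} ≃ {i // y i = a}) := fun a => by
    refine ⟨Fintype.equivOfCardEq ?_⟩
    rw [Fintype.card_subtype, Fintype.card_subtype]
    exact card_filter_eq_of_empDist_eq h a
  refine ⟨(Equiv.sigmaFiberEquiv x).symm.trans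
    ((Equiv.sigmaCongrRight fun a => (e a).some).trans (Equiv.sigmaFiberEquiv y)), ?_⟩
  funext i
  simp only [Function.comp_apply, Equiv.trans_apply]
  exact ((e (x i)).some ⟨i, rfl⟩).2

theorem mem_typeClass [Fintype A] {p : A → ℝ} {x : Fin n → A} :
    x ∈ typeClass n p ↔ empDist x = p := by simp [typeClass]

/-- Every sequence of the second marginal type is completed to a sequence of the joint type in the
same number of ways. -/
theorem card_fiber_mul_card_typeClass [Fintype A] [Fintype B] {p : A × B → ℝ} {v : Fin n → B}
    (hv : empDist v = margSnd p) :
    (Finset.univ.filter fun u : Fin n → A => empJoint u v = p).card *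
      (typeClass n (margSnd p)).card = (typeClass n p).card := by
  have key : ∀ w ∈ typeClass n (margSnd p),
      ((typeClass n p).filter fun z => (fun i => (z i).2) = w).card =
        (Finset.univ.filter fun u : Fin n → A => empJoint u v = p).card := by
    intro w hw
    -- A permutation carrying `v` to `w` acts on both coordinates and identifies the completions of
    -- `v` with those of `w`.
    obtain ⟨σ, hσ⟩ := exists_perm_of_empDist_eq ((mem_typeClass.1 hw).trans hv.symm)
    symm
    refine Finset.card_bij' (fun u _ => fun i => (u (σ i), w i))
      (fun z _ => fun i => (z (σ.symm i)).1) ?_ ?_ ?_ ?_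
    · intro u hu
      have hu' : empJoint u v = p := (Finset.mem_filter.1 hu).2
      refine Finset.mem_filter.2 ⟨mem_typeClass.2 ?_, rfl⟩
      rw [← hu', ← hσ]
      exact empDist_comp_perm (fun i => (u i, v i)) σ
    · intro z hz
      obtain ⟨hz1, hz2⟩ := Finset.mem_filter.1 hz
      refine Finset.mem_filter.2 ⟨Finset.mem_univ _, ?_⟩
      rw [← mem_typeClass.1 hz1, ← empDist_comp_perm z σ.symm]
      unfold empJoint
      congr 1
      funext i
      have h1 : w (σ.symm i) = v i := by rw [← hσ]; simp
      have h2 : (z (σ.symm i)).2 = w (σ.symm i) := congrFun hz2 _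
      exact Prod.ext rfl (h1.symm.trans h2.symm)
    · intro u _; funext i; simp
    · intro z hz
      obtain ⟨hz1, hz2⟩ := Finset.mem_filter.1 hz
      funext i
      have h2 : (z i).2 = w i := congrFun hz2 _
      exact Prod.ext (by simp) h2.symm
  rw [Finset.card_eq_sum_card_fiberwise (f := fun z : Fin n → A × B => fun i => (z i).2)
    (s := typeClass n p) (t := typeClass n (margSnd p)), Finset.sum_congr rfl key]
  · rw [Finset.sum_const, smul_eq_mul, mul_comm]
  · intro z hz
    have hz' : empDist z = p := mem_typeClass.1 hz
    refine mem_typeClass.2 ?_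
    rw [← hz']
    exact (margSnd_empJoint (fun i => (z i).1) (fun i => (z i).2)).symm

/-! ### Probabilities and sizes of type classes -/

/-- The hypothesis `h` rules out zero factors, at which `Real.logb 2 0 = 0` would make the
exponential formula false. -/
theorem prod_eq_two_rpow [Fintype A] (hn : 0 < n) {g : A → ℝ} (hg : ∀ a, 0 ≤ g a) (x : Fin n → A)
    (h : ∀ a, g a = 0 → empDist x a = 0) :
    ∏ i, g (x i) = (2 : ℝ) ^ ((n : ℝ) * ∑ a, empDist x a * Real.logb 2 (g a)) := by
  have hpos : ∀ i, 0 < g (x i) := fun i =>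
    lt_of_le_of_ne (hg _) fun h0 => (empDist_apply_pos x i).ne' (h _ h0.symm)
  rw [sum_empDist_mul hn x fun a => Real.logb 2 (g a), Real.rpow_sum_of_pos two_pos]
  exact Finset.prod_congr rfl fun i _ =>
    (Real.rpow_logb two_pos (by norm_num) (hpos i)).symm

theorem prod_eq_zero_of_empDist_ne_zero {g : A → ℝ} (x : Fin n → A) {a : A} (h0 : g a = 0)
    (h : empDist x a ≠ 0) : ∏ i, g (x i) = 0 := by
  have : (Finset.univ.filter fun i => x i = a).card ≠ 0 := by
    intro hc; apply h; simp [empDist, hc]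
  obtain ⟨i, hi⟩ := Finset.card_ne_zero.1 this
  exact Finset.prod_eq_zero (Finset.mem_univ i) (by rw [(Finset.mem_filter.1 hi).2, h0])

/-- Under the product law $p^n$ each word of the class has probability exactly $2^{-nH(p)}$, and
these probabilities add up to at most $1$. -/
theorem card_typeClass_le [Fintype A] (hn : 0 < n) (p : A → ℝ) :
    ((typeClass n p).card : ℝ) ≤ (2 : ℝ) ^ ((n : ℝ) * entropy p) := by
  rcases (typeClass n p).eq_empty_or_nonempty with h | ⟨x₀, hx₀⟩
  · rw [h]; simp; positivity
  have hp := empDist_mem_stdSimplex hn x₀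
  rw [mem_typeClass.1 hx₀] at hp
  have h1 : ∑ x ∈ typeClass n p, ∏ i, p (x i) ≤ 1 := by
    calc _ ≤ ∑ x : Fin n → A, ∏ i, p (x i) :=
          Finset.sum_le_sum_of_subset_of_nonneg (Finset.subset_univ _)
            fun x _ _ => Finset.prod_nonneg fun i _ => hp.1 _
      _ = 1 := by rw [sum_prod_apply, hp.2, one_pow]
  rw [Finset.sum_congr rfl (g := fun _ => (2 : ℝ) ^ (-((n : ℝ) * entropy p))) ?_] at h1
  · rw [Finset.sum_const, nsmul_eq_mul, Real.rpow_neg two_pos.le, ← div_eq_mul_inv,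
      div_le_one (by positivity)] at h1
    exact h1
  · intro x hx
    have hx' := mem_typeClass.1 hx
    rw [prod_eq_two_rpow hn hp.1 x (by rw [hx']; exact fun _ h => h), hx', entropy]
    ring_nf

/-- A crude Stirling bound. The induction starts from $1! $, since $k! \le e\,k\,(k/e)^k$ fails at
$k = 0$; the weaker factor $3(k+1)$ then covers zero counts too. -/
theorem factorial_le_mul_exp (k : ℕ) :
    (k.factorial : ℝ) ≤ 3 * (k + 1) * ((k : ℝ) ^ k * Real.exp (-k)) := by
  have main : ∀ k : ℕ, ((k + 1).factorial : ℝ) ≤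
      Real.exp 1 * (k + 1) * (((k : ℝ) + 1) ^ (k + 1) * Real.exp (-(k + 1))) := by
    intro k
    induction k with
    | zero => simp [← Real.exp_add]
    | succ k ih =>
      have hk : (0 : ℝ) < k + 1 := by positivity
      have hk2 : (0 : ℝ) < k + 1 + 1 := by positivity
      -- Equivalent to $(1 - 1/(k+2))^{k+2} \le e^{-1}$, which follows from $1 + t \le e^t$.
      have h1 : Real.exp 1 * ((k : ℝ) + 1) ^ (k + 2) ≤ ((k : ℝ) + 1 + 1) ^ (k + 2) := by
        have h2 : Real.exp (-(1 / ((k : ℝ) + 2))) ≥ ((k : ℝ) + 1) / (k + 1 + 1) := by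
          have := Real.add_one_le_exp (-(1 / ((k : ℝ) + 2)))
          refine le_trans (le_of_eq ?_) this
          field_simp; ring
        have h3 : (((k : ℝ) + 1) / (k + 1 + 1)) ^ (k + 2) ≤ Real.exp (-1) := by
          calc _ ≤ (Real.exp (-(1 / ((k : ℝ) + 2)))) ^ (k + 2) :=
                pow_le_pow_left₀ (by positivity) h2 _
            _ = Real.exp (-1) := by
                rw [← Real.exp_nat_mul]; congr 1; push_cast; field_simp
        rw [div_pow, div_le_iff₀ (by positivity)] at h3
        calc Real.exp 1 * ((k : ℝ) + 1) ^ (k + 2)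
            ≤ Real.exp 1 * (Real.exp (-1) * ((k : ℝ) + 1 + 1) ^ (k + 2)) := by gcongr
          _ = _ := by rw [← mul_assoc, ← Real.exp_add]; simp
      rw [Nat.factorial_succ]
      push_cast
      have he : Real.exp (-((k : ℝ) + 1)) = Real.exp 1 * Real.exp (-((k : ℝ) + 1 + 1)) := by
        rw [← Real.exp_add]; congr 1; ring
      calc ((k : ℝ) + 1 + 1) * ((k + 1).factorial : ℝ)
          ≤ ((k : ℝ) + 1 + 1) *
            (Real.exp 1 * (k + 1) * (((k : ℝ) + 1) ^ (k + 1) * Real.exp (-(k + 1)))) := by gcongr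
        _ = Real.exp 1 * ((k : ℝ) + 1 + 1) *
            ((Real.exp 1 * ((k : ℝ) + 1) ^ (k + 2)) * Real.exp (-((k : ℝ) + 1 + 1))) := by
            rw [he]; ring
        _ ≤ Real.exp 1 * ((k : ℝ) + 1 + 1) *
            (((k : ℝ) + 1 + 1) ^ (k + 2) * Real.exp (-((k : ℝ) + 1 + 1))) := by gcongr
  cases k with
  | zero => simp
  | succ k =>
    refine (main k).trans ?_
    push_cast
    have := Real.exp_one_lt_three.le
    gcongr
    linarith

theorem pow_mul_exp_le_factorial (n : ℕ) : (n : ℝ) ^ n * Real.exp (-n) ≤ n.factorial := by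
  have h := Real.pow_div_factorial_le_exp (x := n) (by positivity) n
  rw [div_le_iff₀ (by positivity)] at h
  rw [Real.exp_neg, ← div_eq_mul_inv, div_le_iff₀ (by positivity), mul_comm]
  exact h

/-- A type class is at least as large as the multinomial coefficient of its counts. -/
theorem factorial_le_card_typeClass_mul [Fintype A] (x : Fin n → A) :
    n.factorial ≤ (typeClass n (empDist x)).card *
      ∏ a, (Finset.univ.filter fun i => x i = a).card.factorial := by
  have h := Finset.card_eq_sum_card_fiberwise (s := (Finset.univ : Finset (Equiv.Perm (Fin n))))
    (t := typeClass n (empDist x)) (f := fun σ : Equiv.Perm (Fin n) => x ∘ σ)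
    (fun σ _ => mem_typeClass.2 (empDist_comp_perm x σ))
  rw [Finset.card_univ, Fintype.card_perm, Fintype.card_fin] at h
  rw [h, ← smul_eq_mul, ← Finset.sum_const]
  refine Finset.sum_le_sum fun y hy => ?_
  obtain ⟨τ, hτ⟩ := exists_perm_of_empDist_eq (mem_typeClass.1 hy)
  -- The permutations taking `x` to a fixed `y` form a coset of the stabilizer of `x`, whose order
  -- is the product of the factorials of the counts.
  have h1 := DomMulAct.stabilizer_card x
  simp only [Fintype.card_subtype] at h1
  rw [← h1]
  refine (Finset.card_equiv (Equiv.mulRight τ⁻¹) fun σ => ?_).le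
  simp only [Finset.mem_filter, Finset.mem_univ, true_and, Equiv.coe_mulRight, Equiv.Perm.coe_mul]
  rw [← Function.comp_assoc, ← hτ]
  constructor
  · intro h; rw [h, Function.comp_assoc, ← Equiv.Perm.coe_mul]; simp
  · intro h
    have : x ∘ (σ : Fin n → Fin n) = (x ∘ σ) ∘ (τ⁻¹ : Equiv.Perm (Fin n)) ∘ τ := by
      rw [← Equiv.Perm.coe_mul]; simp
    rw [this, ← Function.comp_assoc, h]

/-- With counts $k_a$, combine $n! \le |T| \prod_a k_a!$ with $(n/e)^n \le n!$ and the Stirling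
upper bound for each $k_a!$. The powers of $e$ cancel because $\sum_a k_a = n$, and $2^{nH}\prod_a
k_a^{k_a} = n^n$ exactly. -/
theorem le_card_typeClass [Fintype A] (hn : 0 < n) {p : A → ℝ} (hp : (typeClass n p).Nonempty) :
    (2 : ℝ) ^ ((n : ℝ) * entropy p) ≤
      (3 * ((n : ℝ) + 1)) ^ Fintype.card A * (typeClass n p).card := by
  obtain ⟨x, hx⟩ := hp
  obtain rfl := mem_typeClass.1 hx
  set k : A → ℕ := fun a => (Finset.univ.filter fun i => x i = a).card with hk
  have hsum : ∑ a, k a = n := by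
    have := Finset.card_eq_sum_card_fiberwise (s := (Finset.univ : Finset (Fin n)))
      (t := Finset.univ) (f := x) (by simp)
    simpa using this.symm
  have h1 : (n.factorial : ℝ) ≤ (typeClass n (empDist x)).card * ∏ a, ((k a).factorial : ℝ) := by
    exact_mod_cast factorial_le_card_typeClass_mul x
  have hkn : ∀ a, (k a : ℝ) ≤ n := fun a => by
    have : k a ≤ n := by
      rw [← hsum]
      exact Finset.single_le_sum (fun _ _ => Nat.zero_le _) (Finset.mem_univ a)
    exact_mod_cast this
  have h2 : ∏ a, ((k a).factorial : ℝ) ≤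
      (3 * ((n : ℝ) + 1)) ^ Fintype.card A * ((∏ a, (k a : ℝ) ^ k a) * Real.exp (-n)) := by
    calc ∏ a, ((k a).factorial : ℝ)
        ≤ ∏ a, (3 * ((n : ℝ) + 1)) * ((k a : ℝ) ^ k a * Real.exp (-(k a))) := by
          refine Finset.prod_le_prod (fun a _ => by positivity) fun a _ => ?_
          refine (factorial_le_mul_exp _).trans ?_
          have := hkn a
          gcongr
      _ = _ := by
          rw [Finset.prod_mul_distrib, Finset.prod_const, Finset.card_univ, Finset.prod_mul_distrib,
            ← Real.exp_sum, Finset.sum_neg_distrib, ← Nat.cast_sum, hsum]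
  have h3 : (2 : ℝ) ^ ((n : ℝ) * entropy (empDist x)) * ∏ a, (k a : ℝ) ^ k a = (n : ℝ) ^ n := by
    have hpos : ∀ a, (0 : ℝ) < (k a : ℝ) ^ k a := fun a => by
      rcases Nat.eq_zero_or_pos (k a) with h | h
      · rw [h]; simp
      · positivity
    have hn' : (0 : ℝ) < n := by positivity
    have e1 : ∏ a, (k a : ℝ) ^ k a = (2 : ℝ) ^ (∑ a, (k a : ℝ) * Real.logb 2 (k a)) := by
      rw [Real.rpow_sum_of_pos two_pos]
      refine Finset.prod_congr rfl fun a _ => ?_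
      rw [← Real.logb_pow, Real.rpow_logb two_pos (by norm_num) (hpos a)]
    have e2 : (n : ℝ) ^ n = (2 : ℝ) ^ ((n : ℝ) * Real.logb 2 n) := by
      rw [← Real.logb_pow, Real.rpow_logb two_pos (by norm_num) (by positivity)]
    rw [e1, e2, ← Real.rpow_add two_pos]
    congr 1
    have e3 : (n : ℝ) * entropy (empDist x) =
        ∑ a, (k a : ℝ) * (Real.logb 2 n - Real.logb 2 (k a)) := by
      rw [entropy, ← Finset.sum_neg_distrib, Finset.mul_sum]
      refine Finset.sum_congr rfl fun a _ => ?_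
      have h4 : empDist x a = (k a : ℝ) / n := rfl
      rcases Nat.eq_zero_or_pos (k a) with h | h
      · rw [h4, h]; simp
      · rw [h4, Real.logb_div (by positivity) (by positivity)]
        field_simp
        ring
    rw [e3, ← Finset.sum_add_distrib]
    rw [Finset.sum_congr rfl (g := fun a => (k a : ℝ) * Real.logb 2 n) (fun a _ => by ring),
      ← Finset.sum_mul, ← Nat.cast_sum, hsum]
  have h4 := pow_mul_exp_le_factorial n
  have hprod : 0 < (∏ a, (k a : ℝ) ^ k a) * Real.exp (-n) := by
    refine mul_pos (Finset.prod_pos fun a _ => ?_) (Real.exp_pos _)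
    rcases Nat.eq_zero_or_pos (k a) with h | h
    · rw [h]; simp
    · positivity
  refine le_of_mul_le_mul_right ?_ hprod
  calc (2 : ℝ) ^ ((n : ℝ) * entropy (empDist x)) * ((∏ a, (k a : ℝ) ^ k a) * Real.exp (-n))
      = (n : ℝ) ^ n * Real.exp (-n) := by rw [← mul_assoc, h3]
    _ ≤ n.factorial := h4
    _ ≤ _ := h1
    _ ≤ (typeClass n (empDist x)).card * ((3 * ((n : ℝ) + 1)) ^ Fintype.card A *
        ((∏ a, (k a : ℝ) ^ k a) * Real.exp (-n))) := by gcongr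
    _ = _ := by ring

/-- The number of types of denominator `n`. -/
theorem card_image_empDist_le [Fintype A] :
    (Finset.univ.image (empDist : (Fin n → A) → A → ℝ)).card ≤ (n + 1) ^ Fintype.card A := by
  have : Finset.univ.image (empDist : (Fin n → A) → A → ℝ) ⊆
      (Finset.univ : Finset (A → Fin (n + 1))).image fun k a => ((k a : ℕ) : ℝ) / n := by
    intro p hp
    obtain ⟨x, -, rfl⟩ := Finset.mem_image.1 hp
    refine Finset.mem_image.2 ⟨fun a => ⟨(Finset.univ.filter fun i => x i = a).card, ?_⟩,
      Finset.mem_univ _, rfl⟩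
    exact Nat.lt_succ_of_le ((Finset.card_le_univ _).trans (by simp))
  refine (Finset.card_le_card this).trans (Finset.card_image_le.trans ?_)
  simp

/-- There is a sequence with prescribed counts. -/
theorem exists_empDist_eq [Fintype A] (k : A → ℕ) (hk : ∑ a, k a = n) :
    ∃ x : Fin n → A, ∀ a, empDist x a = (k a : ℝ) / n := by
  have e : Fin n ≃ (Σ a, Fin (k a)) := Fintype.equivOfCardEq (by simp [hk])
  refine ⟨fun i => (e i).1, fun a => ?_⟩
  unfold empDist
  congr 2
  have : (Finset.univ.filter fun i => (e i).1 = a).card =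
      (Finset.univ.filter fun s : (Σ a, Fin (k a)) => s.1 = a).card :=
    Finset.card_equiv e (by simp)
  rw [this]
  have h2 : (Finset.univ.filter fun s : (Σ a, Fin (k a)) => s.1 = a) =
      Finset.univ.map (Function.Embedding.sigmaMk a) := by
    ext ⟨b, j⟩
    simp only [Finset.mem_filter, Finset.mem_univ, true_and, Finset.mem_map,
      Function.Embedding.sigmaMk_apply]
    constructor
    · rintro rfl; exact ⟨j, rfl⟩
    · rintro ⟨j', h⟩; exact (congrArg Sigma.fst h).symm
  rw [h2, Finset.card_map]
  simp

end Types

/-- A distribution is rounded to integer counts with a prescribed sum, without leaving its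
support. -/
theorem exists_round {A : Type*} [Fintype A] {p : A → ℝ} (hp : p ∈ stdSimplex ℝ A) (N : ℕ) :
    ∃ k : A → ℕ, ∑ a, k a = N ∧ (∀ a, p a = 0 → k a = 0) ∧
      ∀ a, |(k a : ℝ) - N * p a| ≤ Fintype.card A := by
  classical
  obtain ⟨a₀, ha₀⟩ : ∃ a, p a ≠ 0 := by
    by_contra! h
    have := hp.2
    simp [h] at this
  have hf : ∀ a, ((⌊(N : ℝ) * p a⌋₊ : ℕ) : ℝ) ≤ N * p a := fun a =>
    Nat.floor_le (mul_nonneg (Nat.cast_nonneg _) (hp.1 a))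
  have hf' : ∀ a, (N : ℝ) * p a - 1 ≤ ((⌊(N : ℝ) * p a⌋₊ : ℕ) : ℝ) := fun a =>
    (Nat.sub_one_lt_floor _).le
  set S : ℕ := ∑ a, ⌊(N : ℝ) * p a⌋₊ with hS
  have hNp : ∑ a, (N : ℝ) * p a = N := by rw [← Finset.mul_sum, hp.2, mul_one]
  have hSN : S ≤ N := by
    have : (S : ℝ) ≤ N := by
      rw [hS, Nat.cast_sum]
      exact (Finset.sum_le_sum fun a _ => hf a).trans_eq hNp
    exact_mod_cast this
  have hNS : (N : ℝ) - S ≤ Fintype.card A := by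
    have : ∑ a, ((N : ℝ) * p a - 1) ≤ S := by
      rw [hS, Nat.cast_sum]
      exact Finset.sum_le_sum fun a _ => hf' a
    rw [Finset.sum_sub_distrib, hNp] at this
    simp at this
    linarith
  have hcard : (1 : ℝ) ≤ Fintype.card A := by
    have : 0 < Fintype.card A := Fintype.card_pos_iff.2 ⟨a₀⟩
    exact_mod_cast this
  -- Round down everywhere and put the whole deficit, at most the number of letters, on one letter
  -- `a₀` of the support.
  refine ⟨fun a => ⌊(N : ℝ) * p a⌋₊ + if a = a₀ then N - S else 0, ?_, ?_, ?_⟩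
  · rw [Finset.sum_add_distrib, Finset.sum_ite_eq' Finset.univ a₀]
    simp only [Finset.mem_univ, if_true]
    omega
  · intro a ha
    have : a ≠ a₀ := fun h => ha₀ (h ▸ ha)
    simp [ha, this]
  · intro a
    have h1 := hf a
    have h2 := hf' a
    by_cases h : a = a₀
    · simp only [h, if_true]
      rw [h] at h1 h2
      push_cast [Nat.cast_sub hSN]
      have : (S : ℝ) ≤ N := by exact_mod_cast hSN
      rw [abs_le]; constructor <;> linarith
    · simp only [h, if_false, add_zero]
      rw [abs_le]; constructor <;> linarith

/-! ### Averages over random maps -/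

section RandomMaps

open scoped BigOperators

variable {A B T : Type*}

/-- Resampling one value of a uniform random map does not change its law. -/
theorem expect_update [Fintype A] [DecidableEq A] [Fintype B] [Nonempty B]
    (H : (A → B) → ℝ) (u : A) :
    𝔼 f, H f = 𝔼 f, 𝔼 b, H (Function.update f u b) := by
  have h1 : 𝔼 f : A → B, H f = 𝔼 z : (A → B) × B, H z.1 := by
    rw [← Finset.univ_product_univ, Finset.expect_product]
    simp
  have h2 : 𝔼 f, 𝔼 b, H (Function.update f u b) =
      𝔼 z : (A → B) × B, H (Function.update z.1 u z.2) := by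
    rw [← Finset.univ_product_univ, Finset.expect_product]
  -- Exchanging the value at `u` with the fresh sample is an involution, hence preserves the uniform
  -- law on pairs.
  let e : (A → B) × B → (A → B) × B := fun z => (Function.update z.1 u z.2, z.1 u)
  have he : Function.Involutive e := fun z => by simp [e]
  rw [h1, h2]
  exact (Fintype.expect_equiv he.toPerm _ _ fun z => rfl).symm

theorem expect_apply_one [Fintype A] [DecidableEq A] [Fintype B] [Nonempty B]
    (h : B → ℝ) (u : A) : 𝔼 f : A → B, h (f u) = 𝔼 b, h b := by
  rw [expect_update _ u]
  simp

theorem expect_apply_two [Fintype A] [DecidableEq A] [Fintype B] [Nonempty B]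
    (h : B → B → ℝ) {u u' : A} (hu : u ≠ u') :
    𝔼 f : A → B, h (f u) (f u') = 𝔼 b, 𝔼 b', h b b' := by
  rw [expect_update _ u]
  simp only [Function.update_self, Function.update_of_ne hu.symm]
  rw [Finset.expect_comm]
  exact Finset.expect_congr rfl fun b _ => expect_apply_one (h b) u'

theorem expect_apply_three [Fintype A] [DecidableEq A] [Fintype B] [Nonempty B]
    (h : B → B → B → ℝ) {u u' u'' : A} (h1 : u ≠ u') (h2 : u ≠ u'') (h3 : u' ≠ u'') :
    𝔼 f : A → B, h (f u) (f u') (f u'') = 𝔼 b, 𝔼 b', 𝔼 b'', h b b' b'' := by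
  rw [expect_update _ u]
  simp only [Function.update_self, Function.update_of_ne h1.symm, Function.update_of_ne h2.symm]
  rw [Finset.expect_comm]
  exact Finset.expect_congr rfl fun b _ => expect_apply_two (h b) h3

/-- If `i` is the bin of the sent word and its codeword lies in the target set, a competitor
succeeds surely in bin `i` and with probability `q` in any other bin; this averages the two cases.
-/
theorem expect_ite_eq_one [Fintype B] [DecidableEq B] [Nonempty B] (i : B) (q : ℝ) :
    𝔼 j, (if j = i then 1 else q) = q + (1 - q) / Fintype.card B := by
  have : ∀ j, (if j = i then 1 else q) = q + if j = i then 1 - q else 0 := fun j => by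
    split_ifs <;> ring
  simp only [this]
  rw [Finset.expect_add_distrib, Fintype.expect_const, Fintype.expect_eq_sum_div_card]
  simp

theorem expect_indicator_singleton [Fintype T] [DecidableEq T] (x₀ : T) (g : T → ℝ) :
    𝔼 x, (if x = x₀ then 1 else 0) * g x = g x₀ / Fintype.card T := by
  rw [Fintype.expect_eq_sum_div_card]
  simp

/-! ### Random binning followed by a random codebook -/

section RandomCode

variable [Fintype A] [DecidableEq A] [Fintype B] [DecidableEq B] [Nonempty B]
  [Fintype T] [DecidableEq T] [Nonempty T]

/-- The codeword of a source word is uniformly distributed. -/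
theorem expect_code_eq (x₀ : T) (u : A) :
    𝔼 f : A → B, 𝔼 C : B → T, (if C (f u) = x₀ then 1 else 0 : ℝ) = 1 / Fintype.card T := by
  have : ∀ f : A → B, 𝔼 C : B → T, (if C (f u) = x₀ then 1 else 0 : ℝ) = 1 / Fintype.card T :=
    fun f => by
      rw [expect_apply_one (fun x : T => (if x = x₀ then 1 else 0 : ℝ)) (f u)]
      simp
  simp only [this]
  simp

/-- Joint law of the codewords of two source words: they share a bin with probability `1 / |B|`,
and otherwise their codewords are independent. -/
theorem expect_code_two (x₀ : T) (ψ : T → ℝ) {u u' : A} (hu : u ≠ u') :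
    𝔼 f : A → B, 𝔼 C : B → T, (if C (f u) = x₀ then 1 else 0) * ψ (C (f u')) =
      (1 / Fintype.card T) *
        ((𝔼 x, ψ x) + (ψ x₀ - 𝔼 x, ψ x) / Fintype.card B) := by
  rw [expect_apply_two (fun i j => 𝔼 C : B → T, (if C i = x₀ then 1 else 0) * ψ (C j)) hu]
  have key : ∀ i j : B, 𝔼 C : B → T, (if C i = x₀ then 1 else 0) * ψ (C j) =
      (1 / Fintype.card T) * ((𝔼 x, ψ x) + if j = i then ψ x₀ - 𝔼 x, ψ x else 0) := by
    intro i j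
    by_cases h : j = i
    · subst h
      rw [expect_apply_one (fun x => (if x = x₀ then 1 else 0) * ψ x) j,
        expect_indicator_singleton]
      simp; ring
    · rw [expect_apply_two (fun x x' => (if x = x₀ then 1 else 0) * ψ x') (Ne.symm h)]
      simp only [← Finset.mul_expect]
      rw [expect_indicator_singleton x₀ (fun _ => 𝔼 x, ψ x)]
      simp [h]; ring
  simp only [key, ← Finset.mul_expect, Finset.expect_add_distrib, Fintype.expect_const]
  congr 2
  simp only [Fintype.expect_eq_sum_div_card, Finset.sum_ite_eq', Finset.mem_univ, if_true]
  simp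

/-- Second moment bound for the codewords of two source words, given that of a third. -/
theorem expect_code_three_le (x₀ : T) (S : Finset T) (hx₀ : x₀ ∈ S) {u u' u'' : A}
    (h1 : u ≠ u') (h2 : u ≠ u'') (h3 : u' ≠ u'') {q a : ℝ}
    (hq : q = (S.card : ℝ) / Fintype.card T) (ha : a = q + (1 - q) / Fintype.card B) :
    𝔼 f : A → B, 𝔼 C : B → T, (if C (f u) = x₀ then 1 else 0) *
      ((if C (f u') ∈ S then 1 else 0) * (if C (f u'') ∈ S then 1 else 0)) ≤
      (1 / Fintype.card T) * (2 * a ^ 2) := by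
  have hT : (0 : ℝ) < Fintype.card T := by exact_mod_cast Fintype.card_pos
  have hB : (0 : ℝ) < Fintype.card B := by exact_mod_cast Fintype.card_pos
  have hq0 : 0 ≤ q := by rw [hq]; positivity
  have hq1 : q ≤ 1 := by
    rw [hq, div_le_one hT]; exact_mod_cast Finset.card_le_univ S
  have hψ : 𝔼 x, (if x ∈ S then 1 else 0 : ℝ) = q := by
    rw [hq, Fintype.expect_eq_sum_div_card]; simp
  have hφ : 𝔼 x, (if x = x₀ then 1 else 0 : ℝ) = 1 / Fintype.card T := by
    simp
  have haB : 1 / (Fintype.card B : ℝ) ≤ a := by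
    rw [ha]
    have : 1 / (Fintype.card B : ℝ) ≤ 1 := by
      rw [div_le_one hB]; exact_mod_cast Fintype.card_pos
    have : 0 ≤ q * (1 - 1 / (Fintype.card B : ℝ)) := mul_nonneg hq0 (by linarith)
    have e : q + (1 - q) / (Fintype.card B : ℝ) =
      1 / (Fintype.card B : ℝ) + q * (1 - 1 / (Fintype.card B : ℝ)) := by ring
    linarith
  have ha0 : 0 ≤ a := le_trans (by positivity) haB
  rw [expect_apply_three (fun i j k => 𝔼 C : B → T, (if C i = x₀ then 1 else 0) *
      ((if C j ∈ S then 1 else 0) * (if C k ∈ S then 1 else 0))) h1 h2 h3]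
  -- `r i j` is the probability that the codeword of bin `j` lies in `S`, given that bin `i` carries
  -- `x₀`. Two competitors are independent given `i` except when they share a bin; that correction
  -- costs `a / |B|`, which is at most `a ^ 2` by `haB`.
  let r : B → B → ℝ := fun i j => if j = i then 1 else q
  have hr : ∀ i, 𝔼 j, r i j = a := fun i => by rw [ha]; exact expect_ite_eq_one i q
  have hr0 : ∀ i j, 0 ≤ r i j := fun i j => by simp only [r]; split_ifs <;> linarith
  have key : ∀ i j k : B, 𝔼 C : B → T, (if C i = x₀ then 1 else 0) *
      ((if C j ∈ S then 1 else 0) * (if C k ∈ S then 1 else 0)) ≤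
      (1 / Fintype.card T) * (r i j * r i k + r i j * if k = j then 1 else 0) := by
    intro i j k
    by_cases hij : j = i
    · subst hij
      by_cases hik : k = j
      · subst hik
        rw [expect_apply_one (fun x => (if x = x₀ then 1 else 0) *
          ((if x ∈ S then 1 else 0) * (if x ∈ S then 1 else 0))) k,
          expect_indicator_singleton x₀]
        simp only [hx₀, r, if_true]
        rw [div_eq_mul_inv, one_div, mul_comm]
        have := inv_pos.2 hT
        nlinarith
      · rw [expect_apply_two (fun x x' => (if x = x₀ then 1 else 0) *
          ((if x ∈ S then 1 else 0) * (if x' ∈ S then 1 else 0))) (Ne.symm hik)]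
        simp only [← Finset.mul_expect, hψ]
        rw [expect_indicator_singleton x₀ (fun x => (if x ∈ S then 1 else 0) * q)]
        simp only [hx₀, r, if_true, hik, if_false]
        apply le_of_eq; ring
    · by_cases hik : k = i
      · subst hik
        rw [expect_apply_two (fun x x' => (if x = x₀ then 1 else 0) *
          ((if x' ∈ S then 1 else 0) * (if x ∈ S then 1 else 0))) (Ne.symm hij)]
        simp only [← Finset.mul_expect, ← Finset.expect_mul, hψ]
        rw [expect_indicator_singleton x₀ (fun x => q * (if x ∈ S then 1 else 0))]
        simp only [hx₀, r, if_true, hij, Ne.symm hij, if_false]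
        apply le_of_eq; ring
      · by_cases hjk : k = j
        · subst hjk
          rw [expect_apply_two (fun x x' => (if x = x₀ then 1 else 0) *
            ((if x' ∈ S then 1 else 0) * (if x' ∈ S then 1 else 0))) (Ne.symm hij)]
          have e : ∀ x : T, ((if x ∈ S then 1 else 0) * (if x ∈ S then 1 else 0) : ℝ) =
              if x ∈ S then 1 else 0 := fun x => by split_ifs <;> simp
          simp only [e, ← Finset.mul_expect, ← Finset.expect_mul, hψ, hφ]
          simp only [r, hij, if_false, if_true]
          gcongr
          nlinarith
        · rw [expect_apply_three (fun x x' x'' => (if x = x₀ then 1 else 0) *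
            ((if x' ∈ S then 1 else 0) * (if x'' ∈ S then 1 else 0))) (Ne.symm hij) (Ne.symm hik)
            (Ne.symm hjk)]
          simp only [← Finset.mul_expect, ← Finset.expect_mul, hψ, hφ]
          simp only [r, hij, hik, hjk, if_false]
          apply le_of_eq; ring
  calc _ ≤ 𝔼 i : B, 𝔼 j : B, 𝔼 k : B,
        (1 / Fintype.card T : ℝ) * (r i j * r i k + r i j * if k = j then 1 else 0) :=
        Finset.expect_le_expect fun i _ => Finset.expect_le_expect fun j _ =>
          Finset.expect_le_expect fun k _ => key i j k
    _ = (1 / Fintype.card T : ℝ) * (a * a + a * (1 / Fintype.card B)) := by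
        have e : ∀ j : B, 𝔼 k : B, (if k = j then 1 else 0 : ℝ) = 1 / Fintype.card B := fun j => by
          simp
        simp only [← Finset.mul_expect, Finset.expect_add_distrib, e, hr, ← Finset.expect_mul,
          Fintype.expect_const]
    _ ≤ _ := by
        gcongr
        nlinarith

/-- The probability that one of the words in `N` receives a codeword in `S`, jointly with the event
that `u` receives the codeword `x₀ ∈ S`. -/
theorem le_expect_exists_code (x₀ : T) (S : Finset T) (hx₀ : x₀ ∈ S) (u : A) (N : Finset A)
    (hu : u ∉ N) {q a : ℝ} (hq : q = (S.card : ℝ) / Fintype.card T)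
    (ha : a = q + (1 - q) / Fintype.card B) :
    (1 / Fintype.card T) * (min 1 (N.card * a) / 3) ≤
      𝔼 f : A → B, 𝔼 C : B → T, (if C (f u) = x₀ then 1 else 0) *
        (if ∃ u' ∈ N, C (f u') ∈ S then 1 else 0 : ℝ) := by
  have hT : (0 : ℝ) < Fintype.card T := by exact_mod_cast Fintype.card_pos
  have hB : (0 : ℝ) < Fintype.card B := by exact_mod_cast Fintype.card_pos
  have hq0 : 0 ≤ q := by rw [hq]; positivity
  have hq1 : q ≤ 1 := by
    rw [hq, div_le_one hT]; exact_mod_cast Finset.card_le_univ S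
  have ha0 : 0 ≤ a := by
    have : 0 ≤ (1 - q) / (Fintype.card B : ℝ) := div_nonneg (by linarith) hB.le
    linarith
  have hψ : 𝔼 x, (if x ∈ S then 1 else 0 : ℝ) = q := by
    rw [hq, Fintype.expect_eq_sum_div_card]; simp
  set m : ℝ := N.card * a with hm
  have hm0 : 0 ≤ m := by positivity
  -- The indicator of `L > 0` dominates $2lL - l^2L^2$ for every $l$, because $(lL-1)^2 \ge 0$. This
  -- value of $l$ maximizes the resulting bound $2lm - l^2(m + 2m^2)$, giving $m/(1+2m) \ge
  -- \min(1,m)/3$.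
  set l : ℝ := 1 / (1 + 2 * m) with hl
  have hl0 : 0 < l := by positivity
  let L : (A → B) → (B → T) → ℝ := fun f C => ∑ u' ∈ N, if C (f u') ∈ S then 1 else 0
  have hpt : ∀ (f : A → B) (C : B → T), 2 * l * L f C - l ^ 2 * (L f C * L f C) ≤
      (if ∃ u' ∈ N, C (f u') ∈ S then 1 else 0 : ℝ) := by
    intro f C
    split_ifs with h
    · nlinarith [sq_nonneg (l * L f C - 1)]
    · have : L f C = 0 := Finset.sum_eq_zero fun u' hu' => by
        rw [if_neg]; exact fun h' => h ⟨u', hu', h'⟩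
      rw [this]; simp
  have hne : ∀ u' ∈ N, u ≠ u' := fun u' hu' h => hu (h ▸ hu')
  have hfirst : ∀ u' ∈ N, 𝔼 f : A → B, 𝔼 C : B → T, (if C (f u) = x₀ then 1 else 0) *
      (if C (f u') ∈ S then 1 else 0 : ℝ) = (1 / Fintype.card T) * a := by
    intro u' hu'
    rw [expect_code_two x₀ (fun x => if x ∈ S then 1 else 0) (hne u' hu'), hψ, if_pos hx₀, ha]
  have hL1 : 𝔼 f : A → B, 𝔼 C : B → T, (if C (f u) = x₀ then 1 else 0) * L f C =
      (1 / Fintype.card T) * m := by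
    simp only [L, Finset.mul_sum, Finset.expect_sum_comm]
    rw [Finset.sum_congr rfl hfirst, Finset.sum_const, nsmul_eq_mul, hm]
    ring
  have hL2 : 𝔼 f : A → B, 𝔼 C : B → T, (if C (f u) = x₀ then 1 else 0) * (L f C * L f C) ≤
      (1 / Fintype.card T) * (m + 2 * m ^ 2) := by
    simp only [L, Finset.sum_mul_sum]
    simp only [Finset.mul_sum, Finset.expect_sum_comm]
    have hin : ∀ u' ∈ N, ∀ u'' ∈ N, 𝔼 f : A → B, 𝔼 C : B → T, (if C (f u) = x₀ then 1 else 0) *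
        ((if C (f u') ∈ S then 1 else 0) * (if C (f u'') ∈ S then 1 else 0 : ℝ)) ≤
        (1 / Fintype.card T) * (2 * a ^ 2) + if u'' = u' then (1 / Fintype.card T) * a else 0 := by
      intro u' hu' u'' hu''
      by_cases h : u'' = u'
      · subst h
        have e : ∀ (f : A → B) (C : B → T), ((if C (f u'') ∈ S then 1 else 0) *
            (if C (f u'') ∈ S then 1 else 0 : ℝ)) = if C (f u'') ∈ S then 1 else 0 :=
          fun f C => by split_ifs <;> simp
        simp only [e, hfirst u'' hu'', if_true]
        have : 0 ≤ (1 / (Fintype.card T : ℝ)) * (2 * a ^ 2) := by positivity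
        linarith
      · rw [if_neg h, add_zero]
        exact expect_code_three_le x₀ S hx₀ (hne _ hu') (hne _ hu'') (Ne.symm h) hq ha
    calc _ ≤ ∑ u' ∈ N, ∑ u'' ∈ N, ((1 / Fintype.card T) * (2 * a ^ 2) +
          if u'' = u' then (1 / Fintype.card T) * a else 0) :=
          Finset.sum_le_sum fun u' hu' => Finset.sum_le_sum fun u'' hu'' => hin u' hu' u'' hu''
      _ = _ := by
          rw [Finset.sum_congr rfl (g := fun _ =>
            (N.card : ℝ) * ((1 / Fintype.card T) * (2 * a ^ 2)) + (1 / Fintype.card T) * a) (fun u' hu' => by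
              rw [Finset.sum_add_distrib, Finset.sum_ite_eq', if_pos hu', Finset.sum_const,
                nsmul_eq_mul]), Finset.sum_const, nsmul_eq_mul, hm]
          ring
  calc (1 / (Fintype.card T : ℝ)) * (min 1 m / 3)
      ≤ (1 / Fintype.card T) * (2 * l * m - l ^ 2 * (m + 2 * m ^ 2)) := by
        gcongr
        have e : 2 * l * m - l ^ 2 * (m + 2 * m ^ 2) = m / (1 + 2 * m) := by
          rw [hl]; field_simp; ring
        rw [e, div_le_div_iff₀ (by norm_num) (by positivity)]
        rcases le_total 1 m with h | h
        · rw [min_eq_left h]; nlinarith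
        · rw [min_eq_right h]; nlinarith
    _ ≤ 2 * l * (𝔼 f : A → B, 𝔼 C : B → T, (if C (f u) = x₀ then 1 else 0) * L f C) -
        l ^ 2 * 𝔼 f : A → B, 𝔼 C : B → T, (if C (f u) = x₀ then 1 else 0) * (L f C * L f C) := by
        rw [hL1]
        have := mul_le_mul_of_nonneg_left hL2 (sq_nonneg l)
        linarith
    _ = 𝔼 f : A → B, 𝔼 C : B → T, (if C (f u) = x₀ then 1 else 0) *
        (2 * l * L f C - l ^ 2 * (L f C * L f C)) := by
        simp only [Finset.mul_expect, ← Finset.expect_sub_distrib]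
        refine Finset.expect_congr rfl fun f _ => Finset.expect_congr rfl fun C _ => ?_
        ring
    _ ≤ _ := by
        refine Finset.expect_le_expect fun f _ => Finset.expect_le_expect fun C _ => ?_
        refine mul_le_mul_of_nonneg_left (hpt f C) ?_
        split_ifs <;> norm_num

/-- Union bound for the event that a word `u' ≠ u` receives a codeword in `S u'`, jointly with the
event that `u` receives the codeword `x₀`. -/
theorem expect_exists_code_le (x₀ : T) (S : A → Finset T) (u : A) :
    𝔼 f : A → B, 𝔼 C : B → T, (if C (f u) = x₀ then 1 else 0) *
        (if ∃ u', u' ≠ u ∧ C (f u') ∈ S u' then 1 else 0 : ℝ) ≤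
      (1 / Fintype.card T) * min 1 (∑ u', (((S u').card : ℝ) / Fintype.card T +
        (if x₀ ∈ S u' then 1 else 0) / Fintype.card B)) := by
  have hT : (0 : ℝ) < Fintype.card T := by exact_mod_cast Fintype.card_pos
  have hB : (0 : ℝ) < Fintype.card B := by exact_mod_cast Fintype.card_pos
  have hnn : ∀ (f : A → B) (C : B → T), (0 : ℝ) ≤ if C (f u) = x₀ then 1 else 0 := fun f C => by
    split_ifs <;> norm_num
  rw [mul_min_of_nonneg _ _ (by positivity : (0 : ℝ) ≤ 1 / Fintype.card T)]
  refine le_min ?_ ?_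
  · rw [mul_one, ← expect_code_eq (B := B) x₀ u]
    refine Finset.expect_le_expect fun f _ => Finset.expect_le_expect fun C _ => ?_
    refine mul_le_of_le_one_right (hnn f C) ?_
    split_ifs <;> norm_num
  · calc _ ≤ 𝔼 f : A → B, 𝔼 C : B → T, (if C (f u) = x₀ then 1 else 0) *
          ∑ u' ∈ Finset.univ.erase u, (if C (f u') ∈ S u' then 1 else 0 : ℝ) := by
          refine Finset.expect_le_expect fun f _ => Finset.expect_le_expect fun C _ => ?_
          refine mul_le_mul_of_nonneg_left ?_ (hnn f C)
          have h0 : ∀ u' ∈ Finset.univ.erase u, (0 : ℝ) ≤ if C (f u') ∈ S u' then 1 else 0 :=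
            fun u' _ => by split_ifs <;> norm_num
          split_ifs with h
          · obtain ⟨u', hu', hS⟩ := h
            refine le_trans ?_ (Finset.single_le_sum h0
              (Finset.mem_erase.2 ⟨hu', Finset.mem_univ _⟩))
            rw [if_pos hS]
          · exact Finset.sum_nonneg h0
      _ = ∑ u' ∈ Finset.univ.erase u, 𝔼 f : A → B, 𝔼 C : B → T,
          (if C (f u) = x₀ then 1 else 0) * (if C (f u') ∈ S u' then 1 else 0 : ℝ) := by
          simp only [Finset.mul_sum, Finset.expect_sum_comm]
      _ ≤ ∑ u' ∈ Finset.univ.erase u, (1 / Fintype.card T) * (((S u').card : ℝ) / Fintype.card T +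
          (if x₀ ∈ S u' then 1 else 0) / Fintype.card B) := by
          refine Finset.sum_le_sum fun u' hu' => ?_
          have hψ : 𝔼 x, (if x ∈ S u' then 1 else 0 : ℝ) = ((S u').card : ℝ) / Fintype.card T := by
            rw [Fintype.expect_eq_sum_div_card]; simp
          rw [expect_code_two x₀ (fun x => if x ∈ S u' then 1 else 0)
            (Finset.ne_of_mem_erase hu').symm, hψ]
          gcongr
          have : 0 ≤ ((S u').card : ℝ) / Fintype.card T := by positivity
          linarith
      _ ≤ _ := by
          rw [Finset.mul_sum]
          refine Finset.sum_le_sum_of_subset_of_nonneg (Finset.erase_subset _ _) fun u' _ _ => ?_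
          have : (0 : ℝ) ≤ if x₀ ∈ S u' then 1 else 0 := by split_ifs <;> norm_num
          positivity

end RandomCode

end RandomMaps

/-! ### The exponent as a function of a pair of joint distributions -/

/-- The functional `exponentObjective` in terms of the joint distribution `J` of channel input and
output. It is real and continuous, and meaningful where `p` and `J` vanish together with `P`
and `W`. -/
def jointObjective {U V X Y : Type*} [Fintype U] [Fintype V] [Fintype X] [Fintype Y]
    (P : U × V → ℝ) (W : X → Y → ℝ) (R : ℝ) (p : U × V → ℝ) (J : X × Y → ℝ) : ℝ :=
  -entropy p - (∑ a, p a * Real.logb 2 (P a)) - entropy J + entropy (margFst J) -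
    (∑ z, J z * Real.logb 2 (W z.1 z.2)) + max 0 (min R (mutualInfo J) - condEntropy p)

/-- The pairs of joint distributions at which the divergences are finite. -/
def feasiblePairs {U V X Y : Type*} [Fintype U] [Fintype V] [Fintype X] [Fintype Y]
    (P : U × V → ℝ) (W : X → Y → ℝ) : Set ((U × V → ℝ) × (X × Y → ℝ)) :=
  {z | (z.1 ∈ stdSimplex ℝ (U × V) ∧ ∀ a, P a = 0 → z.1 a = 0) ∧
    (z.2 ∈ stdSimplex ℝ (X × Y) ∧ ∀ b, W b.1 b.2 = 0 → z.2 b = 0)}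

theorem mutualInfo_eq_sub {A B : Type*} [Fintype A] [Fintype B] (p : A × B → ℝ) :
    mutualInfo p = entropy (margFst p) - condEntropy p := by
  unfold mutualInfo condEntropy; ring

theorem numBins_pos (R : ℝ) (n : ℕ) : 0 < numBins R n :=
  Nat.ceil_pos.2 (by positivity)

theorem le_numBins (R : ℝ) (n : ℕ) : (2 : ℝ) ^ ((n : ℝ) * R) ≤ numBins R n :=
  Nat.le_ceil _

theorem numBins_le {R : ℝ} (hR : 0 ≤ R) (n : ℕ) :
    (numBins R n : ℝ) ≤ 2 * (2 : ℝ) ^ ((n : ℝ) * R) := by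
  have h1 := (Nat.ceil_lt_add_one (by positivity : (0 : ℝ) ≤ (2 : ℝ) ^ ((n : ℝ) * R))).le
  have h2 : (1 : ℝ) ≤ (2 : ℝ) ^ ((n : ℝ) * R) :=
    Real.one_le_rpow (by norm_num) (by positivity)
  unfold numBins
  linarith

/-! ### Sums over sequences -/

section Sums

variable {A B : Type*} [Fintype A] [Fintype B] [DecidableEq A] [DecidableEq B] {n : ℕ}

theorem card_image_empDist_le_pow :
    ((Finset.univ.image (empDist : (Fin n → A) → A → ℝ)).card : ℝ) ≤
      (3 * ((n : ℝ) + 1)) ^ Fintype.card A := by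
  calc ((Finset.univ.image (empDist : (Fin n → A) → A → ℝ)).card : ℝ)
      ≤ ((n : ℝ) + 1) ^ Fintype.card A := by exact_mod_cast card_image_empDist_le
    _ ≤ _ := by
      gcongr
      have : (0 : ℝ) ≤ n := by positivity
      linarith

/-- Grouped by type, each class contributes at most $1$, so only the number of types remains. -/
theorem sum_two_rpow_entropy_le (hn : 0 < n) :
    ∑ z : Fin n → A, (2 : ℝ) ^ (-((n : ℝ) * entropy (empDist z))) ≤
      (3 * ((n : ℝ) + 1)) ^ Fintype.card A := by
  rw [Finset.sum_comp (fun p => (2 : ℝ) ^ (-((n : ℝ) * entropy p))) empDist]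
  refine (Finset.sum_le_card_nsmul _ _ 1 fun p _ => ?_).trans ?_
  · rw [nsmul_eq_mul, Real.rpow_neg two_pos.le, ← div_eq_mul_inv, div_le_one (by positivity)]
    exact card_typeClass_le hn p
  · rw [nsmul_eq_mul, mul_one]
    exact card_image_empDist_le_pow

/-- A conditional type class has size $|T(p)|/|T(p_V)|$ when nonempty; bound the numerator above and
the denominator below. -/
theorem card_fiber_le (hn : 0 < n) (v : Fin n → B) (p : A × B → ℝ) :
    ((Finset.univ.filter fun u : Fin n → A => empJoint u v = p).card : ℝ) ≤
      (3 * ((n : ℝ) + 1)) ^ Fintype.card B * (2 : ℝ) ^ ((n : ℝ) * condEntropy p) := by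
  rcases (Finset.univ.filter fun u : Fin n → A => empJoint u v = p).eq_empty_or_nonempty with
    h | ⟨u, hu⟩
  · rw [h]; simp; positivity
  have hv : empDist v = margSnd p := by
    rw [← (Finset.mem_filter.1 hu).2, margSnd_empJoint]
  have hne : (typeClass n (margSnd p)).Nonempty := ⟨v, mem_typeClass.2 hv⟩
  have h1 : ((Finset.univ.filter fun u : Fin n → A => empJoint u v = p).card : ℝ) *
      (typeClass n (margSnd p)).card = (typeClass n p).card := by
    exact_mod_cast card_fiber_mul_card_typeClass hv
  have h2 := le_card_typeClass hn hne
  have h3 := card_typeClass_le hn p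
  have hpos : (0 : ℝ) < (typeClass n (margSnd p)).card := by exact_mod_cast hne.card_pos
  refine le_of_mul_le_mul_right ?_ hpos
  rw [h1]
  refine h3.trans ?_
  have e : (n : ℝ) * entropy p = n * condEntropy p + n * entropy (margSnd p) := by
    unfold condEntropy; ring
  rw [e, Real.rpow_add two_pos]
  calc _ ≤ (2 : ℝ) ^ ((n : ℝ) * condEntropy p) *
        ((3 * ((n : ℝ) + 1)) ^ Fintype.card B * (typeClass n (margSnd p)).card) := by gcongr
    _ = _ := by ring

theorem sum_two_rpow_condEntropy_le (hn : 0 < n) (v : Fin n → B) :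
    ∑ u : Fin n → A, (2 : ℝ) ^ (-((n : ℝ) * condEntropy (empJoint u v))) ≤
      (3 * ((n : ℝ) + 1)) ^ (Fintype.card (A × B) + Fintype.card B) := by
  rw [Finset.sum_comp (fun p => (2 : ℝ) ^ (-((n : ℝ) * condEntropy p)))
    (fun u : Fin n → A => empJoint u v)]
  refine (Finset.sum_le_card_nsmul _ _ ((3 * ((n : ℝ) + 1)) ^ Fintype.card B)
    fun p _ => ?_).trans ?_
  · rw [nsmul_eq_mul, Real.rpow_neg two_pos.le, ← div_eq_mul_inv, div_le_iff₀ (by positivity)]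
    exact card_fiber_le hn v p
  · rw [nsmul_eq_mul, pow_add]
    gcongr
    refine le_trans ?_ (card_image_empDist_le_pow (A := A × B) (n := n))
    exact_mod_cast Finset.card_le_card fun p hp => by
      obtain ⟨u, -, rfl⟩ := Finset.mem_image.1 hp
      exact Finset.mem_image.2 ⟨_, Finset.mem_univ _, rfl⟩

theorem sum_sum_eq_sum_prodMk
    {A B : Type*} [Fintype A] [Fintype B] {n : ℕ}
    (g : (Fin n → A × B) → ℝ) :
    ∑ u : Fin n → A, ∑ v : Fin n → B, g (fun i => (u i, v i)) = ∑ z, g z := by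
  rw [← Fintype.sum_prod_type' (f := fun (u : Fin n → A) (v : Fin n → B) => g fun i => (u i, v i))]
  exact (Equiv.arrowProdEquivProdArrow (Fin n) (fun _ => A) (fun _ => B)).symm.sum_comp g

end Sums

/-! ### The error probability as an average over codes, and optimality of MAP -/

section ErrorProb

open scoped BigOperators

variable {U V X Y : Type*} [Fintype U] [Fintype V] [Fintype X] [Fintype Y]
  [DecidableEq U] [DecidableEq V] [DecidableEq X] [DecidableEq Y]

/-- The sum over source words is innermost, so that for fixed code, `v` and `y` the decision is a
single word and decoders can be compared pointwise. -/
theorem errorProb_eq_expect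
    {U V X Y : Type*} [Fintype U] [Fintype V] [Fintype X] [Fintype Y] [DecidableEq U]
    [DecidableEq X]
    {n M : ℕ} {Q : X → ℝ} (P : U × V → ℝ) (W : X → Y → ℝ)
    (δ : Decoder U V Y n M Q) :
    errorProb P W δ = 𝔼 f : Binning U n M, 𝔼 C : Codebook n M Q,
      ∑ v, ∑ y, ∑ u, if δ f C v y ≠ u then mapMetric P W u v (C (f u)) y else 0 := by
  simp only [Fintype.expect_eq_sum_div_card]
  rw [errorProb, ← Finset.sum_div, div_div, mul_comm]
  congr 1
  refine Finset.sum_congr rfl fun f _ => Finset.sum_congr rfl fun C _ => ?_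
  rw [Finset.sum_comm]
  refine Finset.sum_congr rfl fun v _ => ?_
  rw [Finset.sum_comm]
  rfl

/-- The MAP decoder minimizes the error probability. -/
theorem errorProb_map_le
    {U V X Y : Type*} [Fintype U] [Fintype V] [Fintype X] [Fintype Y] [DecidableEq U]
    [DecidableEq X]
    {n M : ℕ} {Q : X → ℝ} {P : U × V → ℝ} {W : X → Y → ℝ}
    {δ δ' : Decoder U V Y n M Q} (hδ : IsArgmaxDecoder (mapMetric P W) δ) :
    errorProb P W δ ≤ errorProb P W δ' := by
  rw [errorProb_eq_expect, errorProb_eq_expect]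
  refine Finset.expect_le_expect fun f _ => Finset.expect_le_expect fun C _ =>
    Finset.sum_le_sum fun v _ => Finset.sum_le_sum fun y _ => ?_
  -- The lost mass is the total mass minus the mass of the decided word, so maximizing the metric
  -- minimizes the loss.
  have key : ∀ d : Fin n → U, (∑ u, if d ≠ u then mapMetric P W u v (C (f u)) y else 0) =
      (∑ u, mapMetric P W u v (C (f u)) y) - mapMetric P W d v (C (f d)) y := by
    intro d
    rw [eq_sub_iff_add_eq]
    have : mapMetric P W d v (C (f d)) y =
        ∑ u, if d = u then mapMetric P W u v (C (f u)) y else 0 := by simp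
    rw [this, ← Finset.sum_add_distrib]
    refine Finset.sum_congr rfl fun u _ => ?_
    by_cases h : d = u <;> simp [h]
  rw [key, key]
  linarith [hδ f C v y (δ' f C v y)]

/-! ### Upper bound on the error probability -/

/-- The properties of a decoding metric that make it universal. -/
structure IsUniversalMetric (R : ℝ) {n : ℕ}
    (m : (Fin n → U) → (Fin n → V) → (Fin n → X) → (Fin n → Y) → ℝ) : Prop where
  le_sub : ∀ {u u' v x x' y}, m u v x y ≤ m u' v x' y →
    min R (mutualInfo (empJoint x y)) - condEntropy (empJoint u v) ≤
      mutualInfo (empJoint x' y) - condEntropy (empJoint u' v)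
  condEntropy_le : ∀ {u u' v x y}, m u v x y ≤ m u' v x y →
    condEntropy (empJoint u' v) ≤ condEntropy (empJoint u v)

/-- Both universal metrics lie between $R \wedge \hat I - \hat H$ and $\hat I - \hat H$, which gives
the first property. With a common codeword the channel terms cancel, which gives the second. -/
theorem isUniversalMetric_gmmiMetric (R : ℝ) {n : ℕ} :
    IsUniversalMetric R (gmmiMetric (U := U) (V := V) (X := X) (Y := Y) (n := n)) where
  le_sub {u u' v x x' y} h := by
    unfold gmmiMetric at h
    linarith [min_le_right R (mutualInfo (empJoint x y))]
  condEntropy_le h := by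
    unfold gmmiMetric at h
    linarith

theorem isUniversalMetric_gmmiMetric' (R : ℝ) {n : ℕ} :
    IsUniversalMetric R (gmmiMetric' (U := U) (V := V) (X := X) (Y := Y) (n := n) R) where
  le_sub {u u' v x x' y} h := by
    unfold gmmiMetric' at h
    linarith [min_le_right R (mutualInfo (empJoint x' y))]
  condEntropy_le h := by
    unfold gmmiMetric' at h
    linarith

/-- The expected number of competitors of a source word, given its codeword. -/
theorem sum_competitors_le {R : ℝ} {n : ℕ} (hn : 0 < n)
    {m : (Fin n → U) → (Fin n → V) → (Fin n → X) → (Fin n → Y) → ℝ} (hm : IsUniversalMetric R m)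
    {Q : X → ℝ} (u : Fin n → U) (v : Fin n → V) (x₀ : ↥(typeClass n Q)) (y : Fin n → Y) :
    ∑ u', (((Finset.univ.filter fun x : ↥(typeClass n Q) => m u v x₀ y ≤ m u' v x y).card : ℝ) /
        Fintype.card ↥(typeClass n Q) +
        (if x₀ ∈ Finset.univ.filter fun x : ↥(typeClass n Q) => m u v x₀ y ≤ m u' v x y
          then 1 else 0) / (numBins R n : ℝ)) ≤
      (3 * ((n : ℝ) + 1)) ^ (1 + Fintype.card (X × Y) + Fintype.card Y + Fintype.card X +
        Fintype.card (U × V) + Fintype.card V) *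
      (2 : ℝ) ^ (-((n : ℝ) *
        (min R (mutualInfo (empJoint (x₀ : Fin n → X) y)) - condEntropy (empJoint u v)))) := by
  set s : ℝ := 3 * ((n : ℝ) + 1) with hs
  have hs1 : 2 ≤ s := by
    have : (0 : ℝ) ≤ n := by positivity
    rw [hs]; linarith
  set c₀ := min R (mutualInfo (empJoint (x₀ : Fin n → X) y)) - condEntropy (empJoint u v) with hc₀
  set H : (Fin n → U) → ℝ := fun u' => condEntropy (empJoint u' v) with hH
  have hne : (typeClass n Q).Nonempty := ⟨x₀.1, x₀.2⟩
  have hTpos : (0 : ℝ) < (typeClass n Q).card := by exact_mod_cast hne.card_pos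
  have hM : (0 : ℝ) < numBins R n := by exact_mod_cast numBins_pos R n
  have h1 : ∀ u', ((Finset.univ.filter fun x : ↥(typeClass n Q) =>
      m u v x₀ y ≤ m u' v x y).card : ℝ) / Fintype.card ↥(typeClass n Q) ≤
      s ^ (Fintype.card (X × Y) + Fintype.card Y + Fintype.card X) *
        ((2 : ℝ) ^ (-((n : ℝ) * c₀)) * (2 : ℝ) ^ (-((n : ℝ) * H u'))) := by
    intro u'
    rw [Fintype.card_coe, div_le_iff₀ hTpos]
    have hT := le_card_typeClass hn hne
    calc ((Finset.univ.filter fun x : ↥(typeClass n Q) => m u v x₀ y ≤ m u' v x y).card : ℝ)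
        = ∑ x : ↥(typeClass n Q), if m u v x₀ y ≤ m u' v x y then (1 : ℝ) else 0 := by simp
      -- For a winning codeword the metric property says $c_0 + \hat H(u'|v) \le H(Q) - \hat
      -- H(x|y)$, so its weight is at least $1$. The constraint can then be dropped, and the sum
      -- over codewords is polynomial.
      _ ≤ ∑ x : ↥(typeClass n Q), (2 : ℝ) ^ ((n : ℝ) * (entropy Q - c₀ - H u')) *
          (2 : ℝ) ^ (-((n : ℝ) * condEntropy (empJoint (x : Fin n → X) y))) := by
          refine Finset.sum_le_sum fun x _ => ?_
          split_ifs with h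
          · rw [← Real.rpow_add two_pos]
            refine Real.one_le_rpow (by norm_num) ?_
            have h2 := hm.le_sub h
            rw [mutualInfo_eq_sub (empJoint (x : Fin n → X) y), margFst_empJoint,
              mem_typeClass.1 x.2] at h2
            have : 0 ≤ entropy Q - c₀ - H u' - condEntropy (empJoint (x : Fin n → X) y) := by
              simp only [hH, hc₀]; linarith
            have := mul_nonneg (Nat.cast_nonneg (α := ℝ) n) this
            linarith
          · positivity
      _ = (2 : ℝ) ^ ((n : ℝ) * (entropy Q - c₀ - H u')) * ∑ x ∈ typeClass n Q,
          (2 : ℝ) ^ (-((n : ℝ) * condEntropy (empJoint x y))) := by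
          rw [← Finset.mul_sum, Finset.sum_coe_sort (typeClass n Q)
            fun x => (2 : ℝ) ^ (-((n : ℝ) * condEntropy (empJoint x y)))]
      _ ≤ (2 : ℝ) ^ ((n : ℝ) * (entropy Q - c₀ - H u')) *
          s ^ (Fintype.card (X × Y) + Fintype.card Y) := by
          gcongr
          refine le_trans ?_ (sum_two_rpow_condEntropy_le hn y)
          exact Finset.sum_le_sum_of_subset_of_nonneg (Finset.subset_univ _)
            fun x _ _ => by positivity
      _ = s ^ (Fintype.card (X × Y) + Fintype.card Y) * ((2 : ℝ) ^ (-((n : ℝ) * c₀)) *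
          (2 : ℝ) ^ (-((n : ℝ) * H u'))) * (2 : ℝ) ^ ((n : ℝ) * entropy Q) := by
          have e : (n : ℝ) * (entropy Q - c₀ - H u') =
            -((n : ℝ) * c₀) + -((n : ℝ) * H u') + (n : ℝ) * entropy Q := by ring
          rw [e, Real.rpow_add two_pos, Real.rpow_add two_pos]; ring
      _ ≤ s ^ (Fintype.card (X × Y) + Fintype.card Y) * ((2 : ℝ) ^ (-((n : ℝ) * c₀)) *
          (2 : ℝ) ^ (-((n : ℝ) * H u'))) * (s ^ Fintype.card X * (typeClass n Q).card) := by
          gcongr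
      _ = _ := by rw [pow_add _ _ (Fintype.card X)]; ring
  -- Same bin: a winning $u'$ has $\hat H(u'|v) \le \hat H(u|v) \le R - c_0$, so $2^{-nR} \le
  -- 2^{-nc_0}2^{-n\hat H(u'|v)}$.
  have h2 : ∀ u', (if x₀ ∈ Finset.univ.filter fun x : ↥(typeClass n Q) =>
      m u v x₀ y ≤ m u' v x y then 1 else 0) / (numBins R n : ℝ) ≤
      (2 : ℝ) ^ (-((n : ℝ) * c₀)) * (2 : ℝ) ^ (-((n : ℝ) * H u')) := by
    intro u'
    rw [div_le_iff₀ hM, ← Real.rpow_add two_pos]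
    refine le_trans ?_ (mul_le_mul_of_nonneg_left (le_numBins R n) (by positivity))
    rw [← Real.rpow_add two_pos]
    split_ifs with h
    · refine Real.one_le_rpow (by norm_num) ?_
      have h3 := hm.condEntropy_le (Finset.mem_filter.1 h).2
      have h4 : 0 ≤ -c₀ - H u' + R := by
        have := min_le_left R (mutualInfo (empJoint (x₀ : Fin n → X) y))
        simp only [hH, hc₀]; linarith
      have := mul_nonneg (Nat.cast_nonneg (α := ℝ) n) h4
      linarith
    · positivity
  have hsum := sum_two_rpow_condEntropy_le (A := U) hn v
  set d := Fintype.card (X × Y) + Fintype.card Y + Fintype.card X with hd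
  have hsd : 1 ≤ s ^ d := one_le_pow₀ (by linarith)
  calc _ ≤ ∑ u', (s ^ d * ((2 : ℝ) ^ (-((n : ℝ) * c₀)) * (2 : ℝ) ^ (-((n : ℝ) * H u'))) +
        (2 : ℝ) ^ (-((n : ℝ) * c₀)) * (2 : ℝ) ^ (-((n : ℝ) * H u'))) :=
        Finset.sum_le_sum fun u' _ => add_le_add (h1 u') (h2 u')
    _ = ((s ^ d + 1) * (2 : ℝ) ^ (-((n : ℝ) * c₀))) * ∑ u', (2 : ℝ) ^ (-((n : ℝ) * H u')) := by
        rw [Finset.mul_sum]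
        exact Finset.sum_congr rfl fun u' _ => by ring
    _ ≤ ((s * s ^ d) * (2 : ℝ) ^ (-((n : ℝ) * c₀))) *
        s ^ (Fintype.card (U × V) + Fintype.card V) := by
        gcongr
        nlinarith
    _ = _ := by
        have e : 1 + Fintype.card (X × Y) + Fintype.card Y + Fintype.card X +
          Fintype.card (U × V) + Fintype.card V =
          1 + d + (Fintype.card (U × V) + Fintype.card V) := by rw [hd]; ring
        rw [e, pow_add s (1 + d), pow_add s 1 d, pow_one]; ring

end ErrorProb

section ErrorBounds

open scoped BigOperators

variable {U V X Y : Type*} [Fintype U] [Fintype V] [Fintype X] [Fintype Y]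
  [DecidableEq U] [DecidableEq V] [DecidableEq X] [DecidableEq Y]

theorem mapMetric_eq_two_rpow {P : U × V → ℝ} (hP : ∀ a, 0 ≤ P a) {W : X → Y → ℝ}
    (hW : ∀ x y, 0 ≤ W x y) {n : ℕ} (hn : 0 < n) (u : Fin n → U) (v : Fin n → V) (x : Fin n → X)
    (y : Fin n → Y) (h1 : ∀ a, P a = 0 → empJoint u v a = 0)
    (h2 : ∀ b : X × Y, W b.1 b.2 = 0 → empJoint x y b = 0) :
    mapMetric P W u v x y = (2 : ℝ) ^ ((n : ℝ) *
      ((∑ a, empJoint u v a * Real.logb 2 (P a)) +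
        ∑ b, empJoint x y b * Real.logb 2 (W b.1 b.2))) := by
  rw [mul_add, Real.rpow_add two_pos]
  exact congrArg₂ (· * ·) (prod_eq_two_rpow hn hP (fun i => (u i, v i)) h1)
    (prod_eq_two_rpow hn (g := fun b : X × Y => W b.1 b.2) (fun b => hW _ _)
      (fun i => (x i, y i)) h2)

theorem mapMetric_eq_zero_of_left
    {U V X Y : Type*} [DecidableEq U] [DecidableEq V]
    {P : U × V → ℝ} {W : X → Y → ℝ} {n : ℕ} (u : Fin n → U)
    (v : Fin n → V) (x : Fin n → X) (y : Fin n → Y) (h : ¬ ∀ a, P a = 0 → empJoint u v a = 0) :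
    mapMetric P W u v x y = 0 := by
  push Not at h
  obtain ⟨a, h0, h1⟩ := h
  exact mul_eq_zero_of_left (prod_eq_zero_of_empDist_ne_zero (fun i => (u i, v i)) h0 h1) _

theorem mapMetric_eq_zero_of_right
    {U V X Y : Type*} [DecidableEq X] [DecidableEq Y]
    {P : U × V → ℝ} {W : X → Y → ℝ} {n : ℕ} (u : Fin n → U)
    (v : Fin n → V) (x : Fin n → X) (y : Fin n → Y)
    (h : ¬ ∀ b : X × Y, W b.1 b.2 = 0 → empJoint x y b = 0) :
    mapMetric P W u v x y = 0 := by
  push Not at h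
  obtain ⟨b, h0, h1⟩ := h
  exact mul_eq_zero_of_right _ (prod_eq_zero_of_empDist_ne_zero (g := fun b : X × Y => W b.1 b.2)
    (fun i => (x i, y i)) h0 h1)

theorem mapMetric_nonneg {U V X Y : Type*} {P : U × V → ℝ} (hP : ∀ a, 0 ≤ P a) {W : X → Y → ℝ}
    (hW : ∀ x y, 0 ≤ W x y) {n : ℕ} (u : Fin n → U) (v : Fin n → V) (x : Fin n → X)
    (y : Fin n → Y) : 0 ≤ mapMetric P W u v x y :=
  mul_nonneg (Finset.prod_nonneg fun _ _ => hP _) (Finset.prod_nonneg fun _ _ => hW _ _)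

/-- The positive part in the exponent comes from here: a union bound exceeding $1$ is replaced by
$1$. -/
theorem min_one_mul_two_rpow_le {K : ℝ} (hK : 1 ≤ K) (n : ℕ) (c : ℝ) :
    min 1 (K * (2 : ℝ) ^ (-((n : ℝ) * c))) ≤ K * (2 : ℝ) ^ (-((n : ℝ) * max 0 c)) := by
  rcases le_total 0 c with h | h
  · rw [max_eq_right h]; exact min_le_right _ _
  · rw [max_eq_left h]; simpa using Or.inl hK

/-- Achievability: an arg-max decoder with a universal metric attains the exponent of the worst
pair of joint types. -/
theorem errorProb_le {P : U × V → ℝ} (hP : ∀ a, 0 ≤ P a) {W : X → Y → ℝ}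
    (hW : ∀ x y, 0 ≤ W x y) {R : ℝ} {n : ℕ} (hn : 0 < n)
    {m : (Fin n → U) → (Fin n → V) → (Fin n → X) → (Fin n → Y) → ℝ} (hm : IsUniversalMetric R m)
    {Q : X → ℝ} (hQ : (typeClass n Q).Nonempty) {δ : Decoder U V Y n (numBins R n) Q}
    (hδ : IsArgmaxDecoder m δ) {e : ℝ}
    (he : ∀ z ∈ feasiblePairs P W, margFst z.2 = Q → e ≤ jointObjective P W R z.1 z.2) :
    errorProb P W δ ≤
      (3 * ((n : ℝ) + 1)) ^ (1 + Fintype.card (X × Y) + Fintype.card Y + Fintype.card X +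
        Fintype.card (U × V) + Fintype.card V + Fintype.card X + Fintype.card (U × V) +
        Fintype.card (X × Y)) * (2 : ℝ) ^ (-((n : ℝ) * e)) := by
  set s : ℝ := 3 * ((n : ℝ) + 1) with hs
  have hs1 : 1 ≤ s := by
    have : (0 : ℝ) ≤ n := by positivity
    rw [hs]; linarith
  set d := 1 + Fintype.card (X × Y) + Fintype.card Y + Fintype.card X +
        Fintype.card (U × V) + Fintype.card V with hd
  have : Nonempty ↥(typeClass n Q) := ⟨⟨_, hQ.choose_spec⟩⟩
  have : Nonempty (Fin (numBins R n)) := ⟨⟨0, numBins_pos R n⟩⟩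
  have hTpos : (0 : ℝ) < (typeClass n Q).card := by exact_mod_cast hQ.card_pos
  let S : (Fin n → U) → (Fin n → V) → (Fin n → Y) → ↥(typeClass n Q) → (Fin n → U) →
      Finset ↥(typeClass n Q) := fun u v y x₀ u' =>
    Finset.univ.filter fun x => m u v x₀ y ≤ m u' v x y
  have hpt : ∀ f C v y u, (if δ f C v y ≠ u then mapMetric P W u v (C (f u)) y else 0) ≤
      ∑ x₀ : ↥(typeClass n Q), mapMetric P W u v x₀ y * ((if C (f u) = x₀ then 1 else 0) *
        (if ∃ u', u' ≠ u ∧ C (f u') ∈ S u v y x₀ u' then 1 else 0)) := by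
    intro f C v y u
    have h0 : ∀ x₀ ∈ (Finset.univ : Finset ↥(typeClass n Q)), 0 ≤ mapMetric P W u v x₀ y *
        ((if C (f u) = x₀ then 1 else 0) *
          (if ∃ u', u' ≠ u ∧ C (f u') ∈ S u v y x₀ u' then 1 else 0)) := fun x₀ _ => by
      refine mul_nonneg (mapMetric_nonneg hP hW _ _ _ _) (mul_nonneg ?_ ?_) <;>
        split_ifs <;> norm_num
    by_cases h : δ f C v y ≠ u
    · refine le_trans ?_ (Finset.single_le_sum h0 (Finset.mem_univ (C (f u))))
      have h' : ∃ u', u' ≠ u ∧ C (f u') ∈ S u v y (C (f u)) u' :=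
        ⟨δ f C v y, h, Finset.mem_filter.2 ⟨Finset.mem_univ _, hδ f C v y u⟩⟩
      rw [if_pos h, if_pos rfl, if_pos h']
      simp
    · rw [if_neg h]; exact Finset.sum_nonneg h0
  have hterm : ∀ (v : Fin n → V) (y : Fin n → Y) (u : Fin n → U) (x₀ : ↥(typeClass n Q)),
      mapMetric P W u v x₀ y * (𝔼 f : Binning U n (numBins R n), 𝔼 C : Codebook n (numBins R n) Q,
        (if C (f u) = x₀ then 1 else 0) *
          (if ∃ u', u' ≠ u ∧ C (f u') ∈ S u v y x₀ u' then 1 else 0 : ℝ)) ≤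
      (s ^ (d + Fintype.card X) * (2 : ℝ) ^ (-((n : ℝ) * e))) *
        ((2 : ℝ) ^ (-((n : ℝ) * entropy (empJoint u v))) *
          (2 : ℝ) ^ (-((n : ℝ) * entropy (empJoint (x₀ : Fin n → X) y)))) := by
    intro v y u x₀
    by_cases hac1 : ∀ a, P a = 0 → empJoint u v a = 0
    swap
    · rw [mapMetric_eq_zero_of_left _ _ _ _ hac1, zero_mul]; positivity
    by_cases hac2 : ∀ b : X × Y, W b.1 b.2 = 0 → empJoint (x₀ : Fin n → X) y b = 0
    swap
    · rw [mapMetric_eq_zero_of_right _ _ _ _ hac2, zero_mul]; positivity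
    have hmarg : margFst (empJoint (x₀ : Fin n → X) y) = Q := by
      rw [margFst_empJoint]; exact mem_typeClass.1 x₀.2
    have hobj := he (empJoint u v, empJoint (x₀ : Fin n → X) y)
      ⟨⟨empDist_mem_stdSimplex hn _, hac1⟩, ⟨empDist_mem_stdSimplex hn _, hac2⟩⟩ hmarg
    have h1 := expect_exists_code_le (B := Fin (numBins R n)) x₀ (S u v y x₀) u
    have h2 := sum_competitors_le hn hm u v x₀ y
    rw [← hs, ← hd] at h2
    set c := min R (mutualInfo (empJoint (x₀ : Fin n → X) y)) - condEntropy (empJoint u v) with hc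
    have h3 : 1 / (Fintype.card ↥(typeClass n Q) : ℝ) ≤
        s ^ Fintype.card X * (2 : ℝ) ^ (-((n : ℝ) * entropy Q)) := by
      rw [Fintype.card_coe, div_le_iff₀ hTpos, Real.rpow_neg two_pos.le]
      have := le_card_typeClass hn hQ
      rw [← hs] at this
      field_simp
      exact this
    have h4 : 𝔼 f : Binning U n (numBins R n), 𝔼 C : Codebook n (numBins R n) Q,
        (if C (f u) = x₀ then 1 else 0) *
          (if ∃ u', u' ≠ u ∧ C (f u') ∈ S u v y x₀ u' then 1 else 0 : ℝ) ≤
        (s ^ Fintype.card X * (2 : ℝ) ^ (-((n : ℝ) * entropy Q))) *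
          (s ^ d * (2 : ℝ) ^ (-((n : ℝ) * max 0 c))) := by
      refine h1.trans ?_
      refine mul_le_mul h3 ?_ (le_min zero_le_one (Finset.sum_nonneg fun u' _ => ?_))
        (by positivity)
      · refine le_trans (min_le_min_left _ ?_) (min_one_mul_two_rpow_le (one_le_pow₀ hs1) n c)
        rw [Fintype.card_fin]
        exact h2
      · have : (0 : ℝ) ≤ if x₀ ∈ S u v y x₀ u' then 1 else 0 := by split_ifs <;> norm_num
        positivity
    refine (mul_le_mul_of_nonneg_left h4 (mapMetric_nonneg hP hW _ _ _ _)).trans ?_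
    rw [mapMetric_eq_two_rpow hP hW hn _ _ _ _ hac1 hac2]
    set L1 := ∑ a, empJoint u v a * Real.logb 2 (P a)
    set L2 := ∑ b : X × Y, empJoint (x₀ : Fin n → X) y b * Real.logb 2 (W b.1 b.2)
    have e1 : (2 : ℝ) ^ ((n : ℝ) * (L1 + L2)) * (s ^ Fintype.card X *
        (2 : ℝ) ^ (-((n : ℝ) * entropy Q)) * (s ^ d * (2 : ℝ) ^ (-((n : ℝ) * max 0 c)))) =
        s ^ (d + Fintype.card X) *
          (2 : ℝ) ^ ((n : ℝ) * (L1 + L2 - entropy Q - max 0 c)) := by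
      have : (n : ℝ) * (L1 + L2 - entropy Q - max 0 c) =
        (n : ℝ) * (L1 + L2) + -((n : ℝ) * entropy Q) + -((n : ℝ) * max 0 c) := by ring
      rw [this, Real.rpow_add two_pos, Real.rpow_add two_pos, pow_add]
      ring
    rw [e1, mul_assoc, ← Real.rpow_add two_pos, ← Real.rpow_add two_pos]
    gcongr
    · norm_num
    -- The bound `he` at this pair of types leaves exactly the factors $2^{-nH(p)}$ and $2^{-nH(J)}$
    -- that make the sums over words polynomial.
    · have h5 : L1 + L2 - entropy Q - max 0 c ≤
          -e - entropy (empJoint u v) - entropy (empJoint (x₀ : Fin n → X) y) := by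
        simp only [jointObjective, hmarg] at hobj
        linarith
      have := mul_le_mul_of_nonneg_left h5 (Nat.cast_nonneg (α := ℝ) n)
      linarith
  rw [errorProb_eq_expect]
  calc _ ≤ 𝔼 f : Binning U n (numBins R n), 𝔼 C : Codebook n (numBins R n) Q,
        ∑ v : Fin n → V, ∑ y : Fin n → Y, ∑ u : Fin n → U,
        ∑ x₀ : ↥(typeClass n Q), mapMetric P W u v x₀ y * ((if C (f u) = x₀ then 1 else 0) *
        (if ∃ u', u' ≠ u ∧ C (f u') ∈ S u v y x₀ u' then 1 else 0)) :=
        Finset.expect_le_expect fun f _ => Finset.expect_le_expect fun C _ =>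
          Finset.sum_le_sum fun v _ => Finset.sum_le_sum fun y _ => Finset.sum_le_sum fun u _ =>
            hpt f C v y u
    _ = ∑ v : Fin n → V, ∑ y : Fin n → Y, ∑ u : Fin n → U,
        ∑ x₀ : ↥(typeClass n Q), mapMetric P W u v x₀ y *
        (𝔼 f : Binning U n (numBins R n), 𝔼 C : Codebook n (numBins R n) Q,
        (if C (f u) = x₀ then 1 else 0) *
          (if ∃ u', u' ≠ u ∧ C (f u') ∈ S u v y x₀ u' then 1 else 0 : ℝ)) := by
        simp only [Finset.expect_sum_comm, ← Finset.mul_expect]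
    _ ≤ ∑ v : Fin n → V, ∑ y : Fin n → Y, ∑ u : Fin n → U,
        ∑ x₀ : ↥(typeClass n Q), (s ^ (d + Fintype.card X) * (2 : ℝ) ^ (-((n : ℝ) * e))) *
        ((2 : ℝ) ^ (-((n : ℝ) * entropy (empJoint u v))) *
          (2 : ℝ) ^ (-((n : ℝ) * entropy (empJoint (x₀ : Fin n → X) y)))) :=
          Finset.sum_le_sum fun v _ => Finset.sum_le_sum fun y _ => Finset.sum_le_sum fun u _ =>
            Finset.sum_le_sum fun x₀ _ => hterm v y u x₀
    _ = (s ^ (d + Fintype.card X) * (2 : ℝ) ^ (-((n : ℝ) * e))) *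
        ((∑ u : Fin n → U, ∑ v : Fin n → V, (2 : ℝ) ^ (-((n : ℝ) * entropy (empJoint u v)))) *
        ∑ x₀ : ↥(typeClass n Q), ∑ y : Fin n → Y,
          (2 : ℝ) ^ (-((n : ℝ) * entropy (empJoint (x₀ : Fin n → X) y)))) := by
        rw [Finset.sum_comm (s := (Finset.univ : Finset (Fin n → U))),
          Finset.sum_comm (s := (Finset.univ : Finset ↥(typeClass n Q)))]
        simp only [← Finset.mul_sum, ← Finset.sum_mul]
    _ ≤ (s ^ (d + Fintype.card X) * (2 : ℝ) ^ (-((n : ℝ) * e))) *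
        (s ^ Fintype.card (U × V) * s ^ Fintype.card (X × Y)) := by
        gcongr
        · have := sum_two_rpow_entropy_le (A := U × V) hn
          rw [← sum_sum_eq_sum_prodMk] at this
          exact this
        · have := sum_two_rpow_entropy_le (A := X × Y) hn
          rw [← sum_sum_eq_sum_prodMk] at this
          refine le_trans ?_ this
          rw [Finset.sum_coe_sort (typeClass n Q) fun x => ∑ y : Fin n → Y,
            (2 : ℝ) ^ (-((n : ℝ) * entropy (empJoint x y)))]
          exact Finset.sum_le_sum_of_subset_of_nonneg (Finset.subset_univ _)
            fun x _ _ => by positivity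
    _ = _ := by rw [pow_add s (d + _ + _), pow_add s (d + _)]; ring

end ErrorBounds

/-! ### Lower bound on the error probability -/

/-- A class with at least two words loses at most one of them to the decision `d`, and $k \le
2(k-1)$ for $k \ge 2$; a class with at most one word contributes nothing. -/
theorem card_filter_exists_ne_le {A : Type*} [DecidableEq A] (s : Finset A) (d : A) :
    (s.filter fun u => ∃ u' ∈ s, u' ≠ u).card ≤ 2 * (s.erase d).card := by
  rcases le_or_gt s.card 1 with h | h
  · have : (s.filter fun u => ∃ u' ∈ s, u' ≠ u) = ∅ := by
      refine Finset.filter_eq_empty_iff.2 fun u hu => ?_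
      rintro ⟨u', hu', hne⟩
      exact hne (Finset.card_le_one.1 h u' hu' u hu)
    simp [this]
  · have h1 := Finset.card_filter_le s fun u => ∃ u' ∈ s, u' ≠ u
    have h2 := Finset.pred_card_le_card_erase (s := s) (a := d)
    omega

theorem sum_ite_empDist_eq {A : Type*} [Fintype A] [DecidableEq A] {n : ℕ} (p : A → ℝ) :
    (∑ z : Fin n → A, if empDist z = p then (1 : ℝ) else 0) = (typeClass n p).card := by
  simp [typeClass]

section Converse

open scoped BigOperators

variable {U V X Y : Type*} [Fintype U] [Fintype V] [Fintype X] [Fintype Y]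
  [DecidableEq U] [DecidableEq V] [DecidableEq X] [DecidableEq Y]

/-- By `h2` every fibre has at least two elements, so removing `u` costs at most a factor $2$; the
fibre size is the quotient of the two type class sizes. -/
theorem le_card_competitors {n : ℕ} (hn : 0 < n) {p : U × V → ℝ}
    (h2 : 2 * (typeClass n (margSnd p)).card ≤ (typeClass n p).card) {u : Fin n → U}
    {v : Fin n → V} (huv : empJoint u v = p) :
    (2 : ℝ) ^ ((n : ℝ) * condEntropy p) ≤ 2 * (3 * ((n : ℝ) + 1)) ^ Fintype.card (U × V) *
      ((Finset.univ.filter fun u' : Fin n → U => empJoint u' v = p).erase u).card := by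
  have hv : empDist v = margSnd p := by rw [← huv, margSnd_empJoint]
  have hVpos : 0 < (typeClass n (margSnd p)).card := Finset.card_pos.2 ⟨v, mem_typeClass.2 hv⟩
  have h1 := card_fiber_mul_card_typeClass hv
  set F := Finset.univ.filter fun u' : Fin n → U => empJoint u' v = p with hF
  have hF2 : 2 ≤ F.card := by
    rw [← h1] at h2
    exact Nat.le_of_mul_le_mul_right h2 hVpos
  have huF : u ∈ F := Finset.mem_filter.2 ⟨Finset.mem_univ _, huv⟩
  have hcard : (F.card : ℝ) ≤ 2 * (F.erase u).card := by
    rw [Finset.card_erase_of_mem huF]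
    exact_mod_cast (by omega : F.card ≤ 2 * (F.card - 1))
  have h3 : (F.card : ℝ) * (typeClass n (margSnd p)).card = (typeClass n p).card := by
    exact_mod_cast h1
  have h4 := le_card_typeClass hn (p := p) ⟨fun i => (u i, v i), mem_typeClass.2 huv⟩
  have h5 := card_typeClass_le hn (margSnd p)
  set s : ℝ := 3 * ((n : ℝ) + 1) with hs
  have e : (n : ℝ) * condEntropy p = n * entropy p - n * entropy (margSnd p) := by
    unfold condEntropy; ring
  rw [e, Real.rpow_sub two_pos, div_le_iff₀ (by positivity)]
  calc _ ≤ s ^ Fintype.card (U × V) * (F.card * (typeClass n (margSnd p)).card) := by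
        rw [h3]; exact h4
    _ ≤ s ^ Fintype.card (U × V) * ((2 * (F.erase u).card) *
        (2 : ℝ) ^ ((n : ℝ) * entropy (margSnd p))) := by gcongr
    _ = _ := by ring

/-- The hitting probability is at least $q$ (an independent codeword falls into the class) and at
least $1/M$ (a shared bin). The first is $2^{-nI}$ up to a polynomial, the second at least
$2^{-nR}/2$, and the smaller exponent is used. -/
theorem le_collision_prob {R : ℝ} (hR : 0 ≤ R) {n : ℕ} (hn : 0 < n) {J : X × Y → ℝ} {Q : X → ℝ}
    (hQ : margFst J = Q) {x : Fin n → X} {y : Fin n → Y} (hxy : empJoint x y = J) {q : ℝ}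
    (hq : q = ((Finset.univ.filter fun x : ↥(typeClass n Q) =>
      empJoint (x : Fin n → X) y = J).card : ℝ) / (typeClass n Q).card) :
    (2 : ℝ) ^ (-((n : ℝ) * min R (mutualInfo J))) ≤
      2 * (3 * ((n : ℝ) + 1)) ^ Fintype.card (X × Y) * (q + (1 - q) / numBins R n) := by
  have hx : x ∈ typeClass n Q := mem_typeClass.2 (by rw [← hQ, ← hxy, margFst_empJoint])
  have hy : empDist y = margSnd J := by rw [← hxy, margSnd_empJoint]
  have hQpos : (0 : ℝ) < (typeClass n Q).card := by
    exact_mod_cast Finset.card_pos.2 ⟨x, hx⟩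
  have hYpos : (0 : ℝ) < (typeClass n (margSnd J)).card := by
    exact_mod_cast Finset.card_pos.2 ⟨y, mem_typeClass.2 hy⟩
  have hcard : (Finset.univ.filter fun x : ↥(typeClass n Q) =>
      empJoint (x : Fin n → X) y = J).card =
      (Finset.univ.filter fun x : Fin n → X => empJoint x y = J).card := by
    refine Finset.card_bij (fun x _ => x.1) (fun x hx => by simpa using hx)
      (fun a _ b _ h => Subtype.ext h) fun x hx => ?_
    have hx' : empJoint x y = J := (Finset.mem_filter.1 hx).2
    exact ⟨⟨x, mem_typeClass.2 (by rw [← hQ, ← hx', margFst_empJoint])⟩, by simpa using hx', rfl⟩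
  have h1 : ((Finset.univ.filter fun x : Fin n → X => empJoint x y = J).card : ℝ) *
      (typeClass n (margSnd J)).card = (typeClass n J).card := by
    exact_mod_cast card_fiber_mul_card_typeClass hy
  rw [hcard] at hq
  have hq0 : 0 ≤ q := by rw [hq]; positivity
  have hq1 : q ≤ 1 := by
    rw [hq, ← hcard, div_le_one hQpos]
    exact_mod_cast (Finset.card_le_univ _).trans (by rw [Fintype.card_coe])
  have hM : (0 : ℝ) < numBins R n := by exact_mod_cast numBins_pos R n
  have hM1 : (1 : ℝ) ≤ numBins R n := by exact_mod_cast numBins_pos R n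
  set s : ℝ := 3 * ((n : ℝ) + 1) with hs
  have hs1 : 1 ≤ s ^ Fintype.card (X × Y) := one_le_pow₀ (by
    have : (0 : ℝ) ≤ n := by positivity
    rw [hs]; linarith)
  set a := q + (1 - q) / (numBins R n : ℝ) with ha
  have haq : q ≤ a := by
    have : 0 ≤ (1 - q) / (numBins R n : ℝ) := div_nonneg (by linarith) hM.le
    linarith
  have haM : 1 / (numBins R n : ℝ) ≤ a := by
    have h3 : 1 / (numBins R n : ℝ) ≤ 1 := by rw [div_le_one hM]; exact hM1
    have : 0 ≤ q * (1 - 1 / (numBins R n : ℝ)) := mul_nonneg hq0 (by linarith)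
    have e : a = 1 / (numBins R n : ℝ) + q * (1 - 1 / (numBins R n : ℝ)) := by rw [ha]; ring
    linarith
  have ha0 : 0 ≤ a := hq0.trans haq
  rcases min_choice R (mutualInfo J) with h | h <;> rw [h]
  · have h3 : (2 : ℝ) ^ (-((n : ℝ) * R)) ≤ 2 * (1 / (numBins R n : ℝ)) := by
      rw [Real.rpow_neg two_pos.le, ← one_div, mul_one_div, div_le_div_iff₀ (by positivity) hM,
        one_mul]
      exact numBins_le hR n
    calc _ ≤ 2 * (1 / (numBins R n : ℝ)) := h3
      _ ≤ 2 * a := by linarith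
      _ ≤ 2 * a * s ^ Fintype.card (X × Y) := le_mul_of_one_le_right (by linarith) hs1
      _ = _ := by ring
  · have h4 := le_card_typeClass hn (p := J) ⟨fun i => (x i, y i), mem_typeClass.2 hxy⟩
    have h5 := card_typeClass_le hn (margSnd J)
    have h6 := card_typeClass_le hn Q
    have e : -((n : ℝ) * mutualInfo J) =
        n * entropy J - (n * entropy Q + n * entropy (margSnd J)) := by
      rw [mutualInfo, hQ]; ring
    have h7 : (2 : ℝ) ^ (-((n : ℝ) * mutualInfo J)) ≤ s ^ Fintype.card (X × Y) * q := by
      rw [e, Real.rpow_sub two_pos, Real.rpow_add two_pos, div_le_iff₀ (by positivity)]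
      calc _ ≤ s ^ Fintype.card (X × Y) * (typeClass n J).card := h4
        _ = s ^ Fintype.card (X × Y) *
            (q * ((typeClass n Q).card * (typeClass n (margSnd J)).card)) := by
            rw [← h1, hq]; field_simp
        _ ≤ s ^ Fintype.card (X × Y) * (q * ((2 : ℝ) ^ ((n : ℝ) * entropy Q) *
            (2 : ℝ) ^ ((n : ℝ) * entropy (margSnd J)))) := by gcongr
        _ = _ := by ring
    calc _ ≤ s ^ Fintype.card (X × Y) * q := h7
      _ ≤ s ^ Fintype.card (X × Y) * a := by gcongr
      _ ≤ _ := by nlinarith [mul_nonneg (zero_le_one.trans hs1) ha0]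

/-- Every decoder errs on at least half of each class of two or more equally likely source
words. -/
theorem le_sum_errors
    {U V X Y : Type*} [Fintype U] [Fintype X] [DecidableEq U] [DecidableEq X]
    {P : U × V → ℝ} (hP : ∀ a, 0 ≤ P a) {W : X → Y → ℝ}
    (hW : ∀ x y, 0 ≤ W x y) {n : ℕ} {Q : X → ℝ} {w : ℝ} (hw0 : 0 ≤ w) (d : Fin n → U)
    (v : Fin n → V) (y : Fin n → Y) (c : (Fin n → U) → ↥(typeClass n Q))
    (N : Finset (Fin n → U)) (S : Finset ↥(typeClass n Q))
    (hw : ∀ u ∈ N, ∀ x ∈ S, mapMetric P W u v x y = w) :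
    ∑ u ∈ N, ∑ x₀ ∈ S, (w / 2) * ((if c u = x₀ then 1 else 0) *
      (if ∃ u' ∈ N.erase u, c u' ∈ S then 1 else 0)) ≤
      ∑ u, if d ≠ u then mapMetric P W u v (c u) y else 0 := by
  set K := N.filter fun u => c u ∈ S with hK
  have h1 : ∀ u ∈ N, ∑ x₀ ∈ S, (w / 2) * ((if c u = x₀ then 1 else 0) *
      (if ∃ u' ∈ N.erase u, c u' ∈ S then 1 else 0)) =
      if c u ∈ S ∧ ∃ u' ∈ K, u' ≠ u then w / 2 else 0 := by
    intro u _
    have hiff : (∃ u' ∈ N.erase u, c u' ∈ S) ↔ ∃ u' ∈ K, u' ≠ u := by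
      simp only [hK, Finset.mem_erase, Finset.mem_filter]
      constructor
      · rintro ⟨u', ⟨a, b⟩, e⟩; exact ⟨u', ⟨b, e⟩, a⟩
      · rintro ⟨u', ⟨b, e⟩, a⟩; exact ⟨u', ⟨a, b⟩, e⟩
    rw [← Finset.mul_sum, ← Finset.sum_mul, Finset.sum_ite_eq]
    simp only [hiff]
    by_cases ha : c u ∈ S <;> by_cases hb : ∃ u' ∈ K, u' ≠ u <;> simp only [ha, hb, if_true,
      if_false, and_self, and_false, false_and, mul_one, mul_zero]
  rw [Finset.sum_congr rfl h1, ← Finset.sum_filter, Finset.sum_const, nsmul_eq_mul,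
    ← Finset.filter_filter, ← hK]
  have h2 : ((K.filter fun u => ∃ u' ∈ K, u' ≠ u).card : ℝ) ≤ 2 * (K.erase d).card := by
    exact_mod_cast card_filter_exists_ne_le K d
  calc _ ≤ (2 * (K.erase d).card : ℝ) * (w / 2) := by gcongr
    _ = ∑ u ∈ K.erase d, w := by rw [Finset.sum_const, nsmul_eq_mul]; ring
    _ = ∑ u ∈ K.erase d, if d ≠ u then mapMetric P W u v (c u) y else 0 := by
        refine Finset.sum_congr rfl fun u hu => ?_
        obtain ⟨hne, hu'⟩ := Finset.mem_erase.1 hu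
        obtain ⟨huN, huS⟩ := Finset.mem_filter.1 hu'
        rw [if_pos (Ne.symm hne), hw u huN _ huS]
    _ ≤ _ := by
        refine Finset.sum_le_sum_of_subset_of_nonneg (Finset.subset_univ _) fun u _ _ => ?_
        split_ifs
        · exact mapMetric_nonneg hP hW _ _ _ _
        · exact le_rfl

/-- Converse: for every decoder, every pair of joint types bounds the exponent of the error
probability. -/
theorem le_errorProb {P : U × V → ℝ} (hP : ∀ a, 0 ≤ P a) {W : X → Y → ℝ}
    (hW : ∀ x y, 0 ≤ W x y) {R : ℝ} (hR : 0 ≤ R) {n : ℕ} (hn : 0 < n) {p : U × V → ℝ}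
    {J : X × Y → ℝ} {Q : X → ℝ} (hp : (typeClass n p).Nonempty) (hJ : (typeClass n J).Nonempty)
    (hp0 : ∀ a, P a = 0 → p a = 0) (hJ0 : ∀ b : X × Y, W b.1 b.2 = 0 → J b = 0)
    (hQ : margFst J = Q) (h2 : 2 * (typeClass n (margSnd p)).card ≤ (typeClass n p).card)
    (δ : Decoder U V Y n (numBins R n) Q) :
    (2 : ℝ) ^ (-((n : ℝ) * jointObjective P W R p J)) ≤
      (3 * ((n : ℝ) + 1)) ^ (2 * Fintype.card (U × V) + 2 * Fintype.card (X × Y) + 2) *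
        errorProb P W δ := by
  set s : ℝ := 3 * ((n : ℝ) + 1) with hs
  have hs6 : 6 ≤ s := by
    have : (1 : ℝ) ≤ n := by exact_mod_cast hn
    rw [hs]; linarith
  set L1 := ∑ a, p a * Real.logb 2 (P a) with hL1
  set L2 := ∑ b : X × Y, J b * Real.logb 2 (W b.1 b.2) with hL2
  set w : ℝ := (2 : ℝ) ^ ((n : ℝ) * (L1 + L2)) with hw
  have hw0 : 0 < w := by positivity
  have hww : ∀ (u : Fin n → U) (v : Fin n → V) (x : Fin n → X) (y : Fin n → Y),
      empJoint u v = p → empJoint x y = J → mapMetric P W u v x y = w := by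
    intro u v x y h1 h2
    rw [mapMetric_eq_two_rpow hP hW hn u v x y (by rw [h1]; exact hp0) (by rw [h2]; exact hJ0),
      h1, h2]
  obtain ⟨z₀, hz₀⟩ := hJ
  have hQne : (typeClass n Q).Nonempty := ⟨fun i => (z₀ i).1, mem_typeClass.2 (by
    rw [← hQ, ← mem_typeClass.1 hz₀]
    exact (margFst_empJoint (fun i => (z₀ i).1) fun i => (z₀ i).2).symm)⟩
  have : Nonempty ↥(typeClass n Q) := ⟨⟨_, hQne.choose_spec⟩⟩
  have : Nonempty (Fin (numBins R n)) := ⟨⟨0, numBins_pos R n⟩⟩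
  have hQpos : (0 : ℝ) < (typeClass n Q).card := by exact_mod_cast hQne.card_pos
  let N : (Fin n → V) → Finset (Fin n → U) := fun v =>
    Finset.univ.filter fun u => empJoint u v = p
  let S : (Fin n → Y) → Finset ↥(typeClass n Q) := fun y =>
    Finset.univ.filter fun x => empJoint (x : Fin n → X) y = J
  set g := max 0 (min R (mutualInfo J) - condEntropy p) with hg
  set k := Fintype.card (U × V) + Fintype.card (X × Y) with hk
  -- A lower bound for $\min(1, |N|a)$; the factor `4 * s ^ k` multiplies the losses of
  -- `le_card_competitors` and `le_collision_prob`.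
  set κ : ℝ := (2 : ℝ) ^ (-((n : ℝ) * g)) / (4 * s ^ k) with hκ
  have hκ0 : 0 < κ := by positivity
  have hκ1 : κ ≤ 1 := by
    have h3 : (2 : ℝ) ^ (-((n : ℝ) * g)) ≤ 1 :=
      Real.rpow_le_one_of_one_le_of_nonpos (by norm_num)
        (neg_nonpos.2 (mul_nonneg (Nat.cast_nonneg _) (le_max_left _ _)))
    have h4 : 1 ≤ s ^ k := one_le_pow₀ (by linarith)
    rw [hκ, div_le_one (by positivity)]
    linarith
  have hterm : ∀ (v : Fin n → V) (y : Fin n → Y), ∀ u ∈ N v, ∀ x₀ ∈ S y,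
      (1 / (typeClass n Q).card) * (κ / 3) ≤
      𝔼 f : Binning U n (numBins R n), 𝔼 C : Codebook n (numBins R n) Q,
        (if C (f u) = x₀ then 1 else 0) *
          (if ∃ u' ∈ (N v).erase u, C (f u') ∈ S y then 1 else 0 : ℝ) := by
    intro v y u hu x₀ hx₀
    have huv : empJoint u v = p := (Finset.mem_filter.1 hu).2
    have hxy : empJoint (x₀ : Fin n → X) y = J := (Finset.mem_filter.1 hx₀).2
    have h3 := le_expect_exists_code (B := Fin (numBins R n)) x₀ (S y) hx₀ u ((N v).erase u)
      (Finset.notMem_erase u _) rfl rfl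
    rw [Fintype.card_coe, Fintype.card_fin] at h3
    refine le_trans ?_ h3
    have h4 := le_card_competitors hn h2 huv
    have h5 := le_collision_prob hR hn hQ hxy rfl
    rw [← hs] at h4 h5
    gcongr
    refine le_min hκ1 ?_
    rw [hκ, div_le_iff₀ (by positivity)]
    calc (2 : ℝ) ^ (-((n : ℝ) * g))
        ≤ (2 : ℝ) ^ ((n : ℝ) * condEntropy p) *
          (2 : ℝ) ^ (-((n : ℝ) * min R (mutualInfo J))) := by
          rw [← Real.rpow_add two_pos]
          refine Real.rpow_le_rpow_of_exponent_le (by norm_num) ?_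
          have := mul_le_mul_of_nonneg_left (le_max_right 0 (min R (mutualInfo J) - condEntropy p))
            (Nat.cast_nonneg (α := ℝ) n)
          rw [← hg] at this
          linarith
      _ ≤ _ := mul_le_mul h4 h5 (by positivity) (by positivity)
      _ = _ := by rw [hk, pow_add]; ring
  have hcount1 : ∑ v, ((N v).card : ℝ) = (typeClass n p).card := by
    have := sum_sum_eq_sum_prodMk (A := U) (B := V) (n := n)
      fun z => if empDist z = p then (1 : ℝ) else 0
    rw [Finset.sum_comm] at this
    have h3 : ∀ v, ((N v).card : ℝ) =
        ∑ u : Fin n → U, if empDist (fun i => (u i, v i)) = p then (1 : ℝ) else 0 := by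
      intro v
      rw [Finset.sum_boole]
      rfl
    rw [Finset.sum_congr rfl fun v _ => h3 v, this, sum_ite_empDist_eq]
  have hcount2 : ∑ y, ((S y).card : ℝ) = (typeClass n J).card := by
    have := sum_sum_eq_sum_prodMk (A := X) (B := Y) (n := n)
      fun z => if empDist z = J then (1 : ℝ) else 0
    rw [Finset.sum_comm] at this
    have h3 : ∀ y, ((S y).card : ℝ) =
        ∑ x : Fin n → X, if empDist (fun i => (x i, y i)) = J then (1 : ℝ) else 0 := by
      intro y
      rw [Finset.sum_boole]
      norm_cast
      refine Finset.card_bij (fun x _ => x.1) (fun x hx => Finset.mem_filter.2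
          ⟨Finset.mem_univ _, (Finset.mem_filter.1 hx).2⟩)
        (fun a _ b _ h => Subtype.ext h) fun x hx => ?_
      have hx' : empJoint x y = J := (Finset.mem_filter.1 hx).2
      exact ⟨⟨x, mem_typeClass.2 (by rw [← hQ, ← hx', margFst_empJoint])⟩,
        Finset.mem_filter.2 ⟨Finset.mem_univ _, hx'⟩, rfl⟩
    rw [Finset.sum_congr rfl fun y _ => h3 y, this, sum_ite_empDist_eq]
  have hmain : (typeClass n p).card * (typeClass n J).card *
      ((w / 2) * ((1 / (typeClass n Q).card) * (κ / 3))) ≤ errorProb P W δ := by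
    rw [errorProb_eq_expect]
    calc ((typeClass n p).card : ℝ) * (typeClass n J).card *
        ((w / 2) * ((1 / (typeClass n Q).card) * (κ / 3)))
        = ∑ v : Fin n → V, ∑ y : Fin n → Y, ∑ u ∈ N v, ∑ x₀ ∈ S y,
          (w / 2) * ((1 / (typeClass n Q).card) * (κ / 3)) := by
          simp only [Finset.sum_const, nsmul_eq_mul]
          rw [← hcount1, ← hcount2, Finset.sum_mul_sum, Finset.sum_mul]
          refine Finset.sum_congr rfl fun v _ => ?_
          rw [Finset.sum_mul]
          exact Finset.sum_congr rfl fun y _ => by ring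
      _ ≤ ∑ v : Fin n → V, ∑ y : Fin n → Y, ∑ u ∈ N v, ∑ x₀ ∈ S y,
          (w / 2) * 𝔼 f : Binning U n (numBins R n), 𝔼 C : Codebook n (numBins R n) Q,
            (if C (f u) = x₀ then 1 else 0) *
              (if ∃ u' ∈ (N v).erase u, C (f u') ∈ S y then 1 else 0 : ℝ) := by
          refine Finset.sum_le_sum fun v _ => Finset.sum_le_sum fun y _ =>
            Finset.sum_le_sum fun u hu => Finset.sum_le_sum fun x₀ hx₀ => ?_
          exact mul_le_mul_of_nonneg_left (hterm v y u hu x₀ hx₀) (by positivity)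
      _ = 𝔼 f : Binning U n (numBins R n), 𝔼 C : Codebook n (numBins R n) Q,
          ∑ v : Fin n → V, ∑ y : Fin n → Y, ∑ u ∈ N v, ∑ x₀ ∈ S y,
          (w / 2) * ((if C (f u) = x₀ then 1 else 0) *
              (if ∃ u' ∈ (N v).erase u, C (f u') ∈ S y then 1 else 0 : ℝ)) := by
          simp only [Finset.expect_sum_comm, ← Finset.mul_expect]
      _ ≤ _ := by
          refine Finset.expect_le_expect fun f _ => Finset.expect_le_expect fun C _ =>
            Finset.sum_le_sum fun v _ => Finset.sum_le_sum fun y _ => ?_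
          exact le_sum_errors hP hW hw0.le (δ f C v y) v y (fun u => C (f u)) (N v) (S y)
            fun u hu x hx => hww u v x y (Finset.mem_filter.1 hu).2 (Finset.mem_filter.1 hx).2
  have hTp := le_card_typeClass hn hp
  have hTJ := le_card_typeClass hn (p := J) ⟨z₀, hz₀⟩
  have hTQ := card_typeClass_le hn Q
  rw [← hs] at hTp hTJ
  have e1 : (2 : ℝ) ^ (-((n : ℝ) * jointObjective P W R p J)) * (2 : ℝ) ^ ((n : ℝ) * entropy Q) =
      (2 : ℝ) ^ ((n : ℝ) * entropy p) * (2 : ℝ) ^ ((n : ℝ) * entropy J) *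
        (w * (2 : ℝ) ^ (-((n : ℝ) * g))) := by
    rw [hw]
    simp only [← Real.rpow_add two_pos]
    congr 1
    simp only [jointObjective, hQ, ← hg, ← hL1, ← hL2]
    ring
  -- The constant is $4 \cdot 2 \cdot 3$: from `κ`, from losing half of a class, and from the second
  -- moment bound.
  have hs36 : (24 : ℝ) ≤ s ^ 2 := by nlinarith
  have h6 : (2 : ℝ) ^ (-((n : ℝ) * jointObjective P W R p J)) ≤
      s ^ k * ((typeClass n p).card * (typeClass n J).card) *
        (w * (κ * (4 * s ^ k))) / (typeClass n Q).card := by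
    rw [le_div_iff₀ hQpos]
    calc _ ≤ (2 : ℝ) ^ (-((n : ℝ) * jointObjective P W R p J)) *
          (2 : ℝ) ^ ((n : ℝ) * entropy Q) := by gcongr
      _ = _ := e1
      _ ≤ (s ^ Fintype.card (U × V) * (typeClass n p).card) *
          (s ^ Fintype.card (X × Y) * (typeClass n J).card) *
          (w * (2 : ℝ) ^ (-((n : ℝ) * g))) := by gcongr
      _ = _ := by
          have : κ * (4 * s ^ k) = (2 : ℝ) ^ (-((n : ℝ) * g)) := by
            rw [hκ]; field_simp
          rw [this, hk, pow_add]; ring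
  refine h6.trans ?_
  have h0 : 0 ≤ errorProb P W δ := le_trans (by positivity) hmain
  calc _ = 24 * (s ^ k * s ^ k) * ((typeClass n p).card * (typeClass n J).card *
      ((w / 2) * ((1 / (typeClass n Q).card) * (κ / 3)))) := by ring
    _ ≤ s ^ 2 * (s ^ k * s ^ k) * errorProb P W δ := by gcongr
    _ = _ := by
      congr 1
      rw [← pow_add, ← pow_add]
      congr 1
      rw [hk]; ring

end Converse

/-! ### The minimum defining the exponent -/

section Continuity

variable {A B : Type*} [Fintype A] [Fintype B]

theorem continuous_entropy : Continuous (entropy : (A → ℝ) → ℝ) := by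
  unfold entropy
  refine (continuous_finsetSum _ fun a _ => ?_).neg
  have h : Continuous fun x : ℝ => x * Real.logb 2 x := by
    simp only [Real.logb, ← mul_div_assoc]
    exact Real.continuous_mul_log.div_const _
  exact h.comp (continuous_apply a)

theorem continuous_margFst {A B : Type*} [Fintype B] : Continuous (margFst : (A × B → ℝ) → A → ℝ) :=
  continuous_pi fun _ => continuous_finsetSum _ fun _ _ => continuous_apply _

theorem continuous_margSnd {A B : Type*} [Fintype A] : Continuous (margSnd : (A × B → ℝ) → B → ℝ) :=
  continuous_pi fun _ => continuous_finsetSum _ fun _ _ => continuous_apply _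

theorem continuous_condEntropy : Continuous (condEntropy : (A × B → ℝ) → ℝ) :=
  continuous_entropy.sub (continuous_entropy.comp continuous_margSnd)

theorem continuous_mutualInfo : Continuous (mutualInfo : (A × B → ℝ) → ℝ) :=
  ((continuous_entropy.comp continuous_margFst).add
    (continuous_entropy.comp continuous_margSnd)).sub continuous_entropy

end Continuity

section Minimum

variable {U V X Y : Type*} [Fintype U] [Fintype V] [Fintype X] [Fintype Y]

theorem continuous_jointObjective (P : U × V → ℝ) (W : X → Y → ℝ) (R : ℝ) :
    Continuous fun z : (U × V → ℝ) × (X × Y → ℝ) => jointObjective P W R z.1 z.2 := by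
  have h1 : Continuous fun z : (U × V → ℝ) × (X × Y → ℝ) => entropy z.1 :=
    continuous_entropy.comp continuous_fst
  have h2 : Continuous fun z : (U × V → ℝ) × (X × Y → ℝ) => entropy z.2 :=
    continuous_entropy.comp continuous_snd
  have h3 : Continuous fun z : (U × V → ℝ) × (X × Y → ℝ) => entropy (margFst z.2) :=
    continuous_entropy.comp (continuous_margFst.comp continuous_snd)
  have h4 : Continuous fun z : (U × V → ℝ) × (X × Y → ℝ) => mutualInfo z.2 :=
    continuous_mutualInfo.comp continuous_snd
  have h5 : Continuous fun z : (U × V → ℝ) × (X × Y → ℝ) => condEntropy z.1 :=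
    continuous_condEntropy.comp continuous_fst
  unfold jointObjective
  fun_prop

theorem isCompact_feasiblePairs (P : U × V → ℝ) (W : X → Y → ℝ) :
    IsCompact (feasiblePairs P W) := by
  have h : feasiblePairs P W = (stdSimplex ℝ (U × V) ∩ ⋂ a, ⋂ _ : P a = 0, {p | p a = 0}) ×ˢ
      (stdSimplex ℝ (X × Y) ∩ ⋂ b : X × Y, ⋂ _ : W b.1 b.2 = 0, {J | J b = 0}) := by
    ext z
    simp [feasiblePairs, Set.mem_prod]
  rw [h]
  refine IsCompact.prod ?_ ?_
  · exact (isCompact_stdSimplex ℝ _).inter_right (isClosed_iInter fun a => isClosed_iInter fun _ =>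
      isClosed_eq (continuous_apply a) continuous_const)
  · exact (isCompact_stdSimplex ℝ _).inter_right (isClosed_iInter fun a => isClosed_iInter fun _ =>
      isClosed_eq (continuous_apply a) continuous_const)

theorem margFst_joint {X Y : Type*} [Fintype Y] (Q : X → ℝ) {W : X → Y → ℝ}
    (hW : ∀ x, W x ∈ stdSimplex ℝ Y) : margFst (joint Q W) = Q := by
  funext x
  simp only [margFst, joint, ← Finset.mul_sum, (hW x).2, mul_one]

theorem joint_mem_stdSimplex {Q : X → ℝ} (hQ : Q ∈ stdSimplex ℝ X) {W : X → Y → ℝ}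
    (hW : ∀ x, W x ∈ stdSimplex ℝ Y) : joint Q W ∈ stdSimplex ℝ (X × Y) := by
  refine ⟨fun z => mul_nonneg (hQ.1 _) ((hW _).1 _), ?_⟩
  rw [Fintype.sum_prod_type]
  rw [← hQ.2]
  exact Finset.sum_congr rfl fun x _ => congrFun (margFst_joint Q hW) x

theorem exists_isMinOn_jointObjective {P : U × V → ℝ} (hP : P ∈ stdSimplex ℝ (U × V))
    {W : X → Y → ℝ} (hW : ∀ x, W x ∈ stdSimplex ℝ Y) {Q : X → ℝ} (hQ : Q ∈ stdSimplex ℝ X)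
    (R : ℝ) :
    ∃ z ∈ feasiblePairs P W, margFst z.2 = Q ∧ ∀ z' ∈ feasiblePairs P W, margFst z'.2 = Q →
      jointObjective P W R z.1 z.2 ≤ jointObjective P W R z'.1 z'.2 := by
  have hc : IsCompact (feasiblePairs P W ∩ {z | margFst z.2 = Q}) :=
    (isCompact_feasiblePairs P W).inter_right
      (isClosed_eq (continuous_margFst.comp continuous_snd) continuous_const)
  have hne : (feasiblePairs P W ∩ {z | margFst z.2 = Q}).Nonempty :=
    ⟨(P, joint Q W), ⟨⟨hP, fun _ h => h⟩, joint_mem_stdSimplex hQ hW, fun b h => by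
      simp [joint, h]⟩, margFst_joint Q hW⟩
  obtain ⟨z, hz, hmin⟩ := hc.exists_isMinOn hne (continuous_jointObjective P W R).continuousOn
  exact ⟨z, hz.1, hz.2, fun z' h1 h2 => hmin ⟨h1, h2⟩⟩

/-- A joint distribution with first marginal `Q` comes from a channel, which may be chosen to agree
with `W` where `Q` vanishes. -/
theorem exists_channel {X Y : Type*} [Fintype Y] {W : X → Y → ℝ}
    (hW : ∀ x, W x ∈ stdSimplex ℝ Y) {Q : X → ℝ} {J : X × Y → ℝ}
    (hJ : ∀ b, 0 ≤ J b) (hJ0 : ∀ b : X × Y, W b.1 b.2 = 0 → J b = 0)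
    (hQ : margFst J = Q) :
    ∃ W' : X → Y → ℝ, (∀ x, W' x ∈ stdSimplex ℝ Y) ∧ joint Q W' = J ∧
      ∀ x y, W x y = 0 → W' x y = 0 := by
  classical
  have hQ' : ∀ x, ∑ y, J (x, y) = Q x := fun x => congrFun hQ x
  have hQ0 : ∀ x, 0 ≤ Q x := fun x => by rw [← hQ']; exact Finset.sum_nonneg fun y _ => hJ _
  refine ⟨fun x y => if Q x = 0 then W x y else J (x, y) / Q x, fun x => ?_, ?_, ?_⟩
  · by_cases h : Q x = 0
    · simp only [h, if_true]; exact hW x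
    · simp only [h, if_false]
      refine ⟨fun y => div_nonneg (hJ _) (hQ0 x), ?_⟩
      rw [← Finset.sum_div, hQ', div_self h]
  · funext ⟨x, y⟩
    simp only [joint]
    by_cases h : Q x = 0
    · have := (Finset.sum_eq_zero_iff_of_nonneg fun y _ => hJ (x, y)).1 ((hQ' x).trans h) y
        (Finset.mem_univ y)
      rw [this, h, zero_mul]
    · rw [if_neg h]; field_simp
  · intro x y h
    by_cases h' : Q x = 0
    · simp [h', h]
    · simp [h', hJ0 (x, y) h]

/-! ### Extended-real divergences and the joint functional -/

theorem sum_ne_bot {A : Type*} (s : Finset A) {f : A → EReal} (hf : ∀ a, f a ≠ ⊥) :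
    ∑ a ∈ s, f a ≠ ⊥ := by
  classical
  induction s using Finset.induction_on with
  | empty => simp
  | insert a s ha ih =>
    rw [Finset.sum_insert ha]
    exact EReal.add_ne_bot_iff.2 ⟨hf a, ih⟩

/-- Since `⊤ + ⊥ = ⊥` in `EReal`, an infinite summand forces an infinite sum only once `⊥` is
excluded; hence the `ne_bot` lemmas. -/
theorem sum_eq_top {A : Type*} [Fintype A] {f : A → EReal} (hf : ∀ a, f a ≠ ⊥) {a : A}
    (ha : f a = ⊤) : ∑ a, f a = ⊤ := by
  classical
  rw [← Finset.add_sum_erase _ _ (Finset.mem_univ a), ha]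
  exact EReal.top_add_of_ne_bot (sum_ne_bot _ hf)

theorem ereal_coe_sum {A : Type*} (s : Finset A) (f : A → ℝ) :
    ((∑ a ∈ s, f a : ℝ) : EReal) = ∑ a ∈ s, (f a : EReal) := by
  classical
  induction s using Finset.induction_on with
  | empty => simp
  | insert a s ha ih => rw [Finset.sum_insert ha, Finset.sum_insert ha, EReal.coe_add, ih]

theorem relEntropy_ne_bot {A : Type*} [Fintype A] (p q : A → ℝ) : relEntropy p q ≠ ⊥ := by
  unfold relEntropy
  split_ifs
  · exact EReal.coe_ne_bot _
  · simp

theorem relEntropy_eq_coe {A : Type*} [Fintype A] {p q : A → ℝ} (h : ∀ a, q a = 0 → p a = 0) :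
    relEntropy p q = ((∑ a, p a * Real.logb 2 (p a / q a) : ℝ) : EReal) := by
  unfold relEntropy
  rw [if_pos h]

theorem sum_mul_logb_div {A : Type*} [Fintype A] {p q : A → ℝ} (h : ∀ a, q a = 0 → p a = 0) :
    ∑ a, p a * Real.logb 2 (p a / q a) = -entropy p - ∑ a, p a * Real.logb 2 (q a) := by
  rw [entropy, neg_neg, ← Finset.sum_sub_distrib]
  refine Finset.sum_congr rfl fun a _ => ?_
  by_cases hp : p a = 0
  · simp [hp]
  · rw [Real.logb_div hp fun hq => hp (h a hq)]; ring

theorem coe_mul_relEntropy_ne_bot {A : Type*} [Fintype A] {c : ℝ} (hc : 0 ≤ c) (p q : A → ℝ) :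
    (c : EReal) * relEntropy p q ≠ ⊥ := by
  unfold relEntropy
  split_ifs
  · rw [← EReal.coe_mul]; exact EReal.coe_ne_bot _
  · rcases hc.eq_or_lt with rfl | h
    · simp
    · rw [EReal.coe_mul_top_of_pos h]; simp

theorem condRelEntropy_eq_coe {W' W : X → Y → ℝ} {Q : X → ℝ}
    (h : ∀ x, Q x ≠ 0 → ∀ y, W x y = 0 → W' x y = 0) :
    condRelEntropy W' W Q =
      ((∑ x, Q x * ∑ y, W' x y * Real.logb 2 (W' x y / W x y) : ℝ) : EReal) := by
  rw [condRelEntropy, ereal_coe_sum]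
  refine Finset.sum_congr rfl fun x _ => ?_
  by_cases hx : Q x = 0
  · simp [hx]
  · rw [relEntropy_eq_coe (h x hx), EReal.coe_mul]

/-- The chain rule $H(J) = H(Q) + H(Y'|X)$, checked letter by letter. Absolute continuity is needed
only in rows charged by `Q`. -/
theorem sum_mul_sum_logb_div {W' W : X → Y → ℝ} {Q : X → ℝ} (hW' : ∀ x, W' x ∈ stdSimplex ℝ Y)
    (h : ∀ x, Q x ≠ 0 → ∀ y, W x y = 0 → W' x y = 0) :
    ∑ x, Q x * ∑ y, W' x y * Real.logb 2 (W' x y / W x y) =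
      -entropy (joint Q W') + entropy (margFst (joint Q W')) -
        ∑ z, joint Q W' z * Real.logb 2 (W z.1 z.2) := by
  rw [margFst_joint Q hW', entropy, entropy, neg_neg, Fintype.sum_prod_type, Fintype.sum_prod_type,
    ← sub_eq_add_neg, ← Finset.sum_sub_distrib, ← Finset.sum_sub_distrib]
  refine Finset.sum_congr rfl fun x _ => ?_
  have e : Q x * Real.logb 2 (Q x) = ∑ y, W' x y * (Q x * Real.logb 2 (Q x)) := by
    rw [← Finset.sum_mul, (hW' x).2, one_mul]
  rw [e, ← Finset.sum_sub_distrib, ← Finset.sum_sub_distrib, Finset.mul_sum]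
  refine Finset.sum_congr rfl fun y _ => ?_
  simp only [joint]
  by_cases hx : Q x = 0
  · simp [hx]
  by_cases hy : W' x y = 0
  · simp [hy]
  rw [Real.logb_div hy fun h0 => hy (h x hx y h0), Real.logb_mul hx hy]
  ring

theorem exponentObjective_eq_coe {P : U × V → ℝ} {W : X → Y → ℝ} {Q : X → ℝ} {R : ℝ}
    {P' : U × V → ℝ} {W' : X → Y → ℝ} (hP' : ∀ a, P a = 0 → P' a = 0)
    (hW' : ∀ x, W' x ∈ stdSimplex ℝ Y) (h : ∀ x, Q x ≠ 0 → ∀ y, W x y = 0 → W' x y = 0) :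
    exponentObjective P W Q R P' W' = (jointObjective P W R P' (joint Q W') : EReal) := by
  rw [exponentObjective, relEntropy_eq_coe hP', condRelEntropy_eq_coe h, sum_mul_logb_div hP',
    sum_mul_sum_logb_div hW' h, ← EReal.coe_add, ← EReal.coe_add, jointObjective]
  congr 1
  ring

theorem exponentObjective_eq_top {P : U × V → ℝ} {W : X → Y → ℝ} {Q : X → ℝ} (hQ : ∀ x, 0 ≤ Q x)
    {R : ℝ} {P' : U × V → ℝ} {W' : X → Y → ℝ}
    (h : ¬ ((∀ a, P a = 0 → P' a = 0) ∧ ∀ x, Q x ≠ 0 → ∀ y, W x y = 0 → W' x y = 0)) :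
    exponentObjective P W Q R P' W' = ⊤ := by
  have hcond : condRelEntropy W' W Q ≠ ⊥ :=
    sum_ne_bot _ fun x => coe_mul_relEntropy_ne_bot (hQ x) _ _
  have hsum : relEntropy P' P + condRelEntropy W' W Q = ⊤ := by
    by_cases h1 : ∀ a, P a = 0 → P' a = 0
    · have h2 : ¬ ∀ x, Q x ≠ 0 → ∀ y, W x y = 0 → W' x y = 0 := fun h2 => h ⟨h1, h2⟩
      rw [not_forall] at h2
      obtain ⟨x, hx⟩ := h2
      rw [Classical.not_imp] at hx
      have : condRelEntropy W' W Q = ⊤ := by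
        refine sum_eq_top (fun x => coe_mul_relEntropy_ne_bot (hQ x) _ _) (a := x) ?_
        rw [relEntropy, if_neg hx.2, EReal.coe_mul_top_of_pos ((hQ x).lt_of_ne (Ne.symm hx.1))]
      rw [this]
      exact EReal.add_top_of_ne_bot (relEntropy_ne_bot _ _)
    · rw [relEntropy, if_neg h1]
      exact EReal.top_add_of_ne_bot hcond
  rw [exponentObjective, hsum]
  exact EReal.top_add_of_ne_bot (EReal.coe_ne_bot _)

/-- Channels and joint distributions with marginal `Q` correspond up to rows where `Q` vanishes,
which do not affect the functional. Where absolute continuity fails the value is `⊤` and cannot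
undercut the minimum. -/
theorem isLeast_exponentValues {P : U × V → ℝ} {W : X → Y → ℝ} (hW : ∀ x, W x ∈ stdSimplex ℝ Y)
    {Q : X → ℝ} (hQ : Q ∈ stdSimplex ℝ X) {R : ℝ} {z : (U × V → ℝ) × (X × Y → ℝ)}
    (hz : z ∈ feasiblePairs P W) (hzQ : margFst z.2 = Q)
    (hmin : ∀ z' ∈ feasiblePairs P W, margFst z'.2 = Q →
      jointObjective P W R z.1 z.2 ≤ jointObjective P W R z'.1 z'.2) :
    IsLeast (exponentValues P W Q R) (jointObjective P W R z.1 z.2 : EReal) := by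
  constructor
  · obtain ⟨W', hW', hJ, h0⟩ := exists_channel hW hz.2.1.1 hz.2.2 hzQ
    refine ⟨z.1, hz.1.1, W', hW', ?_⟩
    rw [exponentObjective_eq_coe hz.1.2 hW' fun x _ => h0 x, hJ]
  · rintro e ⟨P', hP', W', hW', rfl⟩
    by_cases h : (∀ a, P a = 0 → P' a = 0) ∧ ∀ x, Q x ≠ 0 → ∀ y, W x y = 0 → W' x y = 0
    · rw [exponentObjective_eq_coe h.1 hW' h.2, EReal.coe_le_coe_iff]
      refine hmin (P', joint Q W') ⟨⟨hP', h.1⟩, joint_mem_stdSimplex hQ hW', fun b hb => ?_⟩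
        (margFst_joint Q hW')
      by_cases hx : Q b.1 = 0
      · simp [joint, hx]
      · simp [joint, h.2 _ hx _ hb]
    · rw [exponentObjective_eq_top hQ.1 h]; exact le_top

/-- The minimum is lower semicontinuous in the input distribution. -/
theorem eventually_le_jointObjective {P : U × V → ℝ} {W : X → Y → ℝ} {Q : X → ℝ} {R E : ℝ}
    (hE : ∀ z ∈ feasiblePairs P W, margFst z.2 = Q → E ≤ jointObjective P W R z.1 z.2)
    {Qt : ℕ → X → ℝ} (hQt : Tendsto Qt atTop (𝓝 Q)) {ε : ℝ} (hε : 0 < ε) :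
    ∀ᶠ k in atTop, ∀ z ∈ feasiblePairs P W, margFst z.2 = Qt k →
      E - ε ≤ jointObjective P W R z.1 z.2 := by
  -- The first marginals of the pairs in this compact sublevel set form a closed set that misses
  -- `Q`, hence eventually misses `Qt k`.
  have hc : IsCompact (feasiblePairs P W ∩ {z | jointObjective P W R z.1 z.2 ≤ E - ε}) :=
    (isCompact_feasiblePairs P W).inter_right
      (isClosed_le (continuous_jointObjective P W R) continuous_const)
  have hcl := (hc.image (continuous_margFst.comp continuous_snd)).isClosed
  have hQ : Q ∉ (margFst ∘ Prod.snd) ''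
      (feasiblePairs P W ∩ {z | jointObjective P W R z.1 z.2 ≤ E - ε}) := by
    rintro ⟨z, ⟨hz, hzE⟩, hzQ⟩
    have := hE z hz hzQ
    have hzE' : jointObjective P W R z.1 z.2 ≤ E - ε := hzE
    linarith
  filter_upwards [hQt.eventually (hcl.isOpen_compl.mem_nhds hQ)] with k hk z hz hzQ
  by_contra hlt
  exact hk ⟨z, ⟨hz, (not_le.1 hlt).le⟩, hzQ⟩

/-! ### Positive conditional entropy -/

/-- For nonnegative `p` every term is nonnegative, so positivity is decided by a single atom: one
with $0 < p(u,v) < p_V(v)$. That criterion survives mixing. -/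
theorem condEntropy_eq_sum (p : U × V → ℝ) :
    condEntropy p = ∑ a, p a * (Real.logb 2 (margSnd p a.2) - Real.logb 2 (p a)) := by
  have : ∑ a : U × V, p a * Real.logb 2 (margSnd p a.2) =
      ∑ v, margSnd p v * Real.logb 2 (margSnd p v) := by
    rw [Fintype.sum_prod_type, Finset.sum_comm]
    refine Finset.sum_congr rfl fun v _ => ?_
    exact (Finset.sum_mul Finset.univ (fun u => p (u, v)) (Real.logb 2 (margSnd p v))).symm
  simp only [mul_sub, Finset.sum_sub_distrib, this, condEntropy, entropy]
  ring

theorem le_margSnd {U V : Type*} [Fintype U] {p : U × V → ℝ} (hp : ∀ a, 0 ≤ p a)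
    (a : U × V) : p a ≤ margSnd p a.2 :=
  Finset.single_le_sum (f := fun u => p (u, a.2)) (fun _ _ => hp _) (Finset.mem_univ a.1)

theorem exists_lt_margSnd {p : U × V → ℝ} (hp : ∀ a, 0 ≤ p a) (h : 0 < condEntropy p) :
    ∃ a, 0 < p a ∧ p a < margSnd p a.2 := by
  by_contra! hcon
  refine h.ne' ?_
  rw [condEntropy_eq_sum]
  refine Finset.sum_eq_zero fun a _ => ?_
  rcases (hp a).eq_or_lt with h0 | h0
  · rw [← h0, zero_mul]
  · rw [le_antisymm (le_margSnd hp a) (hcon a h0), sub_self, mul_zero]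

theorem condEntropy_pos {p : U × V → ℝ} (hp : ∀ a, 0 ≤ p a) {a : U × V} (ha : 0 < p a)
    (hlt : p a < margSnd p a.2) : 0 < condEntropy p := by
  rw [condEntropy_eq_sum]
  refine Finset.sum_pos' (fun b _ => ?_) ⟨a, Finset.mem_univ a, mul_pos ha (sub_pos.2 ?_)⟩
  · rcases (hp b).eq_or_lt with h0 | h0
    · rw [← h0, zero_mul]
    · exact mul_nonneg h0.le (sub_nonneg.2
        (Real.logb_le_logb_of_le (by norm_num) h0 (le_margSnd hp b)))
  · exact Real.logb_lt_logb (by norm_num) ha hlt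

/-- The minimum is approached by source distributions of positive conditional entropy. -/
theorem exists_condEntropy_pos {P : U × V → ℝ} (hP : P ∈ stdSimplex ℝ (U × V))
    (hH : 0 < condEntropy P) {W : X → Y → ℝ} {R : ℝ} {z : (U × V → ℝ) × (X × Y → ℝ)}
    (hz : z ∈ feasiblePairs P W) {ε : ℝ} (hε : 0 < ε) :
    ∃ p ∈ stdSimplex ℝ (U × V), (∀ a, P a = 0 → p a = 0) ∧ 0 < condEntropy p ∧
      jointObjective P W R p z.2 < jointObjective P W R z.1 z.2 + ε := by
  obtain ⟨a, ha, ha'⟩ := exists_lt_margSnd hP.1 hH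
  -- The mixture $(1-t)z_1 + tP$ stays feasible and, for $0 < t < 1$, inherits the atom `a` of `P`;
  -- continuity as $t \to 0^+$ controls the objective.
  obtain ⟨c, hcdef⟩ : ∃ c : ℝ → U × V → ℝ, ∀ t b, c t b = (1 - t) * z.1 b + t * P b :=
    ⟨_, fun _ _ => rfl⟩
  have hc : Continuous c := continuous_pi fun b => by simp only [hcdef]; fun_prop
  have hcont : Tendsto (fun t => jointObjective P W R (c t) z.2) (𝓝[>] 0)
      (𝓝 (jointObjective P W R z.1 z.2)) := by
    have h1 : Tendsto (fun t => (c t, z.2)) (𝓝[>] 0) (𝓝 (z.1, z.2)) := by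
      have h2 : c 0 = z.1 := by funext b; simp [hcdef]
      rw [← h2]
      exact ((hc.prodMk continuous_const).tendsto 0).mono_left nhdsWithin_le_nhds
    have h3 := ((continuous_jointObjective P W R).tendsto (z.1, z.2)).comp h1
    simpa only [Function.comp_def] using h3
  have h1 := hcont.eventually (gt_mem_nhds (lt_add_of_pos_right _ hε))
  have h2 : ∀ᶠ t : ℝ in 𝓝[>] 0, t < 1 :=
    (eventually_lt_nhds zero_lt_one).filter_mono nhdsWithin_le_nhds
  obtain ⟨t, ht, ht1, ht0⟩ := (h1.and (h2.and self_mem_nhdsWithin)).exists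
  have ht0' : (0 : ℝ) < t := ht0
  have hnn : ∀ b, 0 ≤ c t b := fun b => hcdef t b ▸
    add_nonneg (mul_nonneg (by linarith) (hz.1.1.1 b)) (mul_nonneg ht0'.le (hP.1 b))
  refine ⟨c t, ⟨hnn, ?_⟩, fun b hb => ?_, ?_, ht⟩
  · simp only [hcdef, Finset.sum_add_distrib, ← Finset.mul_sum, hz.1.1.2, hP.2]; ring
  · simp [hcdef, hb, hz.1.2 b hb]
  · refine condEntropy_pos hnn (a := a) ?_ ?_
    · rw [hcdef]
      exact add_pos_of_nonneg_of_pos (mul_nonneg (by linarith) (hz.1.1.1 a)) (mul_pos ht0' ha)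
    · have e : margSnd (c t) a.2 = (1 - t) * margSnd z.1 a.2 + t * margSnd P a.2 := by
        simp only [margSnd, hcdef, Finset.sum_add_distrib, ← Finset.mul_sum]
      rw [e, hcdef]
      exact add_lt_add_of_le_of_lt
        (mul_le_mul_of_nonneg_left (le_margSnd hz.1.1.1 a) (by linarith))
        (mul_lt_mul_of_pos_left ha' ht0')

end Minimum

/-! ### Asymptotics -/

theorem tendsto_logb_div_atTop :
    Tendsto (fun n : ℕ => Real.logb 2 (3 * ((n : ℝ) + 1)) / n) atTop (𝓝 0) := by
  -- Coefficients chosen so that the denominator at $x = 3(n+1)$ is $n \log 2$.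
  have h1 := Real.tendsto_pow_log_div_mul_add_atTop (Real.log 2 / 3) (-Real.log 2) 1
    (by have := Real.log_pos one_lt_two; positivity)
  have h2 : Tendsto (fun n : ℕ => 3 * ((n : ℝ) + 1)) atTop atTop :=
    (tendsto_atTop_add_const_right _ 1 tendsto_natCast_atTop_atTop).const_mul_atTop (by norm_num)
  refine (h1.comp h2).congr fun n => ?_
  have e : Real.log 2 / 3 * (3 * ((n : ℝ) + 1)) + -Real.log 2 = Real.log 2 * n := by ring
  simp only [Function.comp_apply, pow_one, e, Real.logb, div_div]

theorem eventually_mul_logb_le (d : ℕ) {n : ℕ → ℕ} (hn : Tendsto n atTop atTop) {ε : ℝ}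
    (hε : 0 < ε) :
    ∀ᶠ k in atTop, d * Real.logb 2 (3 * ((n k : ℝ) + 1)) ≤ n k * ε := by
  have h := ((tendsto_logb_div_atTop.comp hn).const_mul (d : ℝ)).eventually_lt_const
    (by simpa using hε : (d : ℝ) * 0 < ε)
  filter_upwards [h, hn.eventually_gt_atTop 0] with k hk hk0
  have hk0' : (0 : ℝ) < n k := by exact_mod_cast hk0
  simp only [Function.comp_apply, ← mul_div_assoc, div_lt_iff₀ hk0'] at hk
  linarith

/-- Polynomial factors cost $o(1)$ in the normalized logarithm. In the proof one third of `ε` goes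
to the exponent and one third to the polynomial; the lower bound also gives the required positivity.
-/
theorem hasExponent_of_bounds {n : ℕ → ℕ} (hn : Tendsto n atTop atTop) {p : ℕ → ℝ} {E : ℝ}
    (d₁ d₂ : ℕ)
    (h₁ : ∀ ε > 0, ∀ᶠ k in atTop,
      p k ≤ (3 * ((n k : ℝ) + 1)) ^ d₁ * (2 : ℝ) ^ (-((n k : ℝ) * (E - ε))))
    (h₂ : ∀ ε > 0, ∀ᶠ k in atTop,
      (2 : ℝ) ^ (-((n k : ℝ) * (E + ε))) ≤ (3 * ((n k : ℝ) + 1)) ^ d₂ * p k) :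
    HasExponent n p E := by
  have hpos : ∀ᶠ k in atTop, 0 < p k := by
    filter_upwards [h₂ 1 one_pos] with k hk
    have h : 0 < (3 * ((n k : ℝ) + 1)) ^ d₂ * p k := lt_of_lt_of_le (by positivity) hk
    exact pos_of_mul_pos_right h (by positivity)
  refine ⟨hpos, Metric.tendsto_nhds.2 fun ε hε => ?_⟩
  have hε' : 0 < ε / 3 := by positivity
  filter_upwards [hpos, h₁ _ hε', h₂ _ hε', eventually_mul_logb_le d₁ hn hε',
    eventually_mul_logb_le d₂ hn hε', hn.eventually_gt_atTop 0] with k hk hk1 hk2 hd1 hd2 hk0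
  have hk0' : (0 : ℝ) < n k := by exact_mod_cast hk0
  have hs : (0 : ℝ) < 3 * ((n k : ℝ) + 1) := by positivity
  have l1 := Real.logb_le_logb_of_le (b := 2) (by norm_num) hk hk1
  rw [Real.logb_mul (by positivity) (by positivity), Real.logb_pow,
    Real.logb_rpow two_pos (by norm_num)] at l1
  have l2 := Real.logb_le_logb_of_le (b := 2) (by norm_num) (by positivity) hk2
  rw [Real.logb_mul (by positivity) hk.ne', Real.logb_pow,
    Real.logb_rpow two_pos (by norm_num)] at l2
  have h0 := mul_pos hk0' hε
  rw [Real.dist_eq, abs_lt]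
  constructor
  · rw [lt_sub_iff_add_lt, lt_div_iff₀ hk0']
    linarith
  · rw [sub_lt_iff_lt_add, div_lt_iff₀ hk0']
    linarith

/-! ### Approximation by types of a given denominator -/

theorem exists_type_near {A : Type*} [Fintype A] [DecidableEq A] {p : A → ℝ}
    (hp : p ∈ stdSimplex ℝ A) {n : ℕ} (hn : 0 < n) :
    ∃ p' : A → ℝ, (typeClass n p').Nonempty ∧ (∀ a, p a = 0 → p' a = 0) ∧
      ∀ a, |p' a - p a| ≤ Fintype.card A / n := by
  obtain ⟨k, hk, h0, hle⟩ := exists_round hp n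
  obtain ⟨x, hx⟩ := exists_empDist_eq k hk
  have hn' : (0 : ℝ) < n := by exact_mod_cast hn
  refine ⟨empDist x, ⟨x, mem_typeClass.2 rfl⟩, fun a ha => by rw [hx, h0 a ha]; simp, fun a => ?_⟩
  have e : (k a : ℝ) / n - p a = ((k a : ℝ) - n * p a) / n := by field_simp
  rw [hx, e, abs_div, abs_of_pos hn']
  gcongr
  exact hle a

/-- Each row $W(\cdot|x)$ is rounded separately to counts summing to $nQ(x)$, so the input marginal
stays exactly `Q`, as the constant-composition codebook requires. -/
theorem exists_joint_type_near {X Y : Type*} [Fintype X] [Fintype Y] [DecidableEq X]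
    [DecidableEq Y] {W : X → Y → ℝ} (hW : ∀ x, W x ∈ stdSimplex ℝ Y) {n : ℕ} (hn : 0 < n)
    {Q : X → ℝ} (hQ : (typeClass n Q).Nonempty) :
    ∃ J : X × Y → ℝ, (typeClass n J).Nonempty ∧ margFst J = Q ∧
      (∀ b : X × Y, W b.1 b.2 = 0 → J b = 0) ∧
      ∀ b, |J b - joint Q W b| ≤ Fintype.card Y / n := by
  obtain ⟨x₀, hx₀⟩ := hQ
  have hn' : (0 : ℝ) < n := by exact_mod_cast hn
  let N : X → ℕ := fun x => (Finset.univ.filter fun i => x₀ i = x).card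
  have hNQ : ∀ x, Q x = (N x : ℝ) / n := fun x => by rw [← mem_typeClass.1 hx₀]; rfl
  have hN : ∑ x, N x = n := by
    have := Finset.card_eq_sum_card_fiberwise (s := (Finset.univ : Finset (Fin n)))
      (t := Finset.univ) (f := x₀) (by simp)
    simpa using this.symm
  choose k hk h0 hle using fun x => exists_round (hW x) (N x)
  obtain ⟨z, hz⟩ := exists_empDist_eq (n := n) (fun b : X × Y => k b.1 b.2) (by
    rw [Fintype.sum_prod_type]; simp only [hk, hN])
  refine ⟨empDist z, ⟨z, mem_typeClass.2 rfl⟩, ?_, fun b hb => by rw [hz, h0 _ _ hb]; simp,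
    fun b => ?_⟩
  · funext x
    simp only [margFst, hz]
    rw [← Finset.sum_div, ← Nat.cast_sum, hk, hNQ]
  · have e : (k b.1 b.2 : ℝ) / n - joint Q W b = ((k b.1 b.2 : ℝ) - N b.1 * W b.1 b.2) / n := by
      rw [joint, hNQ]; field_simp
    rw [hz, e, abs_div, abs_of_pos hn']
    gcongr
    exact hle _ _

theorem tendsto_of_abs_sub_le {A : Type*} {f g : ℕ → A → ℝ} {l : A → ℝ} {n : ℕ → ℕ}
    (hn : Tendsto n atTop atTop) (hg : Tendsto g atTop (𝓝 l)) {c : ℝ}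
    (h : ∀ k, 0 < n k → ∀ a, |f k a - g k a| ≤ c / n k) : Tendsto f atTop (𝓝 l) := by
  rw [tendsto_pi_nhds] at hg ⊢
  intro a
  have h1 : Tendsto (fun k => f k a - g k a) atTop (𝓝 0) := by
    refine squeeze_zero_norm' ?_
      ((tendsto_const_nhds (x := c)).div_atTop (tendsto_natCast_atTop_atTop.comp hn))
    filter_upwards [hn.eventually_gt_atTop 0] with k hk
    exact h k hk a
  simpa using h1.add (hg a)

/-! ### The exponents of the three decoders -/

section Main

variable {U V X Y : Type*} [Fintype U] [Fintype V] [Fintype X] [Fintype Y]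
  [DecidableEq U] [DecidableEq V] [DecidableEq X] [DecidableEq Y]

/-- The converse along a sequence of block lengths, for arbitrary decoders. -/
theorem eventually_le_errorProb {P : U × V → ℝ} (hP : P ∈ stdSimplex ℝ (U × V))
    (hH : 0 < condEntropy P) {W : X → Y → ℝ} (hW : ∀ x, W x ∈ stdSimplex ℝ Y) {Q : X → ℝ} {R : ℝ}
    (hR : 0 ≤ R) {z : (U × V → ℝ) × (X × Y → ℝ)} (hz : z ∈ feasiblePairs P W)
    (hzQ : margFst z.2 = Q) {n : ℕ → ℕ} {Qt : ℕ → X → ℝ} (hn : Tendsto n atTop atTop)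
    (hQt : Tendsto Qt atTop (𝓝 Q)) (hne : ∀ k, (typeClass (n k) (Qt k)).Nonempty)
    (δ : ∀ k, Decoder U V Y (n k) (numBins R (n k)) (Qt k)) {ε : ℝ} (hε : 0 < ε) :
    ∀ᶠ k in atTop, (2 : ℝ) ^ (-((n k : ℝ) * (jointObjective P W R z.1 z.2 + ε))) ≤
      (3 * ((n k : ℝ) + 1)) ^ (2 * Fintype.card (U × V) + 2 * Fintype.card (X × Y) + 2) *
        errorProb P W (δ k) := by
  obtain ⟨p, hp, hp0, hpH, hpE⟩ := exists_condEntropy_pos (R := R) hP hH hz hε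
  -- `hW0` must hold also where `Q` vanishes, since `Qt k` may charge such letters and the
  -- approximating joint types must still avoid the zeros of `W`.
  obtain ⟨W', hW', hJ, hW0⟩ := exists_channel hW hz.2.1.1 hz.2.2 hzQ
  have hpk : ∀ k, ∃ p' : U × V → ℝ, 0 < n k → (typeClass (n k) p').Nonempty ∧
      (∀ a, p a = 0 → p' a = 0) ∧ ∀ a, |p' a - p a| ≤ Fintype.card (U × V) / n k := fun k => by
    by_cases h : 0 < n k
    · obtain ⟨p', h'⟩ := exists_type_near hp h
      exact ⟨p', fun _ => h'⟩
    · exact ⟨0, fun h' => absurd h' h⟩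
  have hJk : ∀ k, ∃ J : X × Y → ℝ, 0 < n k → (typeClass (n k) J).Nonempty ∧ margFst J = Qt k ∧
      (∀ b : X × Y, W' b.1 b.2 = 0 → J b = 0) ∧
      ∀ b, |J b - joint (Qt k) W' b| ≤ Fintype.card Y / n k := fun k => by
    by_cases h : 0 < n k
    · obtain ⟨J, h'⟩ := exists_joint_type_near hW' h (hne k)
      exact ⟨J, fun _ => h'⟩
    · exact ⟨0, fun h' => absurd h' h⟩
  choose pt hpt using hpk
  choose Jt hJt using hJk
  have hplim : Tendsto pt atTop (𝓝 p) :=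
    tendsto_of_abs_sub_le hn tendsto_const_nhds fun k hk => (hpt k hk).2.2
  have hJlim : Tendsto Jt atTop (𝓝 z.2) := by
    refine tendsto_of_abs_sub_le hn (g := fun k => joint (Qt k) W') ?_
      fun k hk => (hJt k hk).2.2.2
    rw [← hJ, tendsto_pi_nhds]
    intro b
    exact ((tendsto_pi_nhds.1 hQt) b.1).mul_const _
  have hobj : ∀ᶠ k in atTop,
      jointObjective P W R (pt k) (Jt k) < jointObjective P W R z.1 z.2 + ε := by
    have h := ((continuous_jointObjective P W R).tendsto (p, z.2)).comp
      (hplim.prodMk_nhds hJlim)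
    simp only [Function.comp_def] at h
    exact h.eventually (gt_mem_nhds hpE)
  have hcond : ∀ᶠ k in atTop, condEntropy p / 2 < condEntropy (pt k) :=
    ((continuous_condEntropy.tendsto p).comp hplim).eventually (lt_mem_nhds (by linarith))
  filter_upwards [hobj, hcond, hn.eventually_gt_atTop 0,
    eventually_mul_logb_le (Fintype.card (U × V) + 1) hn (half_pos hpH)]
    with k hk1 hk2 hk0 hk3
  obtain ⟨hpne, hpac, -⟩ := hpt k hk0
  obtain ⟨hJne, hJQ, hJac, -⟩ := hJt k hk0
  have hk0' : (0 : ℝ) < n k := by exact_mod_cast hk0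
  have h2 : 2 * (typeClass (n k) (margSnd (pt k))).card ≤ (typeClass (n k) (pt k)).card := by
    have h3 := le_card_typeClass hk0 hpne
    have h4 := card_typeClass_le hk0 (margSnd (pt k))
    set s : ℝ := 3 * ((n k : ℝ) + 1) with hs
    have hs2 : 2 ≤ s := by rw [hs]; linarith
    -- Positive conditional entropy beats every polynomial; the extra power of `s` supplies the
    -- factor $2$ in `h2`.
    have h5 : s ^ (Fintype.card (U × V) + 1) ≤ (2 : ℝ) ^ ((n k : ℝ) * condEntropy (pt k)) := by
      rw [← Real.logb_le_iff_le_rpow (by norm_num) (by positivity), Real.logb_pow]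
      refine hk3.trans ?_
      gcongr
    have e : (n k : ℝ) * entropy (pt k) =
        n k * condEntropy (pt k) + n k * entropy (margSnd (pt k)) := by
      unfold condEntropy; ring
    rw [e, Real.rpow_add two_pos] at h3
    have h6 : s ^ Fintype.card (U × V) * (2 * (typeClass (n k) (margSnd (pt k))).card : ℝ) ≤
        s ^ Fintype.card (U × V) * (typeClass (n k) (pt k)).card := by
      calc _ ≤ s ^ Fintype.card (U × V) * (s * (typeClass (n k) (margSnd (pt k))).card) := by
            gcongr
        _ = s ^ (Fintype.card (U × V) + 1) * (typeClass (n k) (margSnd (pt k))).card := by ring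
        _ ≤ (2 : ℝ) ^ ((n k : ℝ) * condEntropy (pt k)) *
            (2 : ℝ) ^ ((n k : ℝ) * entropy (margSnd (pt k))) := by gcongr
        _ ≤ _ := h3
    have h7 := le_of_mul_le_mul_left h6 (by positivity)
    exact_mod_cast h7
  refine le_trans ?_ (le_errorProb hP.1 (fun x y => (hW x).1 y) hR hk0 hpne hJne
    (fun a ha => hpac a (hp0 a ha)) (fun b hb => hJac b (hW0 _ _ hb)) hJQ h2 (δ k))
  refine Real.rpow_le_rpow_of_exponent_le (by norm_num) ?_
  have := mul_le_mul_of_nonneg_left hk1.le hk0'.le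
  linarith

theorem exists_isArgmaxDecoder
    {U V X Y : Type*} [Fintype U] [Fintype X] [DecidableEq X]
    [Nonempty U] {n M : ℕ} {Q : X → ℝ}
    (m : (Fin n → U) → (Fin n → V) → (Fin n → X) → (Fin n → Y) → ℝ) :
    ∃ δ : Decoder U V Y n M Q, IsArgmaxDecoder m δ := by
  choose δ hδ using fun (f : Binning U n M) (C : Codebook n M Q) v y =>
    Finite.exists_max fun u => m u v (C (f u)) y
  exact ⟨δ, hδ⟩

/-- The exponent of the random code, for decoders at least as good as a universal one. -/
theorem hasExponent_errorProb {P : U × V → ℝ} (hP : P ∈ stdSimplex ℝ (U × V))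
    (hH : 0 < condEntropy P) {W : X → Y → ℝ} (hW : ∀ x, W x ∈ stdSimplex ℝ Y) {Q : X → ℝ} {R : ℝ}
    (hR : 0 ≤ R) {z : (U × V → ℝ) × (X × Y → ℝ)} (hz : z ∈ feasiblePairs P W)
    (hzQ : margFst z.2 = Q)
    (hmin : ∀ z' ∈ feasiblePairs P W, margFst z'.2 = Q →
      jointObjective P W R z.1 z.2 ≤ jointObjective P W R z'.1 z'.2)
    {n : ℕ → ℕ} {Qt : ℕ → X → ℝ} (hn : Tendsto n atTop atTop)
    (hQt : Tendsto Qt atTop (𝓝 Q)) (hne : ∀ k, (typeClass (n k) (Qt k)).Nonempty)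
    (δ δ' : ∀ k, Decoder U V Y (n k) (numBins R (n k)) (Qt k))
    (hle : ∀ k, errorProb P W (δ k) ≤ errorProb P W (δ' k))
    {m : ∀ k, (Fin (n k) → U) → (Fin (n k) → V) → (Fin (n k) → X) → (Fin (n k) → Y) → ℝ}
    (hm : ∀ k, IsUniversalMetric R (m k)) (hδ' : ∀ k, IsArgmaxDecoder (m k) (δ' k)) :
    HasExponent n (fun k => errorProb P W (δ k)) (jointObjective P W R z.1 z.2) := by
  refine hasExponent_of_bounds hn (1 + Fintype.card (X × Y) + Fintype.card Y + Fintype.card X +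
    Fintype.card (U × V) + Fintype.card V + Fintype.card X + Fintype.card (U × V) +
    Fintype.card (X × Y)) (2 * Fintype.card (U × V) + 2 * Fintype.card (X × Y) + 2)
    (fun ε hε => ?_) fun ε hε => eventually_le_errorProb hP hH hW hR hz hzQ hn hQt hne δ hε
  filter_upwards [eventually_le_jointObjective hmin hQt hε, hn.eventually_gt_atTop 0] with k hk hk0
  exact (hle k).trans (errorProb_le hP.1 (fun x y => (hW x).1 y) hk0 (hm k) (hne k) (hδ' k) hk)

end Main

end BinningExponent

end

theorem theorem1 {U V X Y : Type*} [Fintype U] [Fintype V] [Fintype X] [Fintype Y]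
    [DecidableEq U] [DecidableEq V] [DecidableEq X] [DecidableEq Y]
    (P : U × V → ℝ) (hP : P ∈ stdSimplex ℝ (U × V))
    (hH : 0 < BinningExponent.condEntropy P)
    (W : X → Y → ℝ) (hW : ∀ x, W x ∈ stdSimplex ℝ Y)
    (Q : X → ℝ) (hQ : Q ∈ stdSimplex ℝ X) (R : ℝ) (hR : 0 < R) :
    ∃ E : ℝ, IsLeast (BinningExponent.exponentValues P W Q R) (E : EReal) ∧
      ∀ (n : ℕ → ℕ) (Qt : ℕ → X → ℝ), Tendsto n atTop atTop → Tendsto Qt atTop (𝓝 Q) →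
        (∀ k, (BinningExponent.typeClass (n k) (Qt k)).Nonempty) →
        ∀ δ : ∀ k, BinningExponent.Decoder U V Y (n k) (BinningExponent.numBins R (n k)) (Qt k),
          ((∀ k, BinningExponent.IsArgmaxDecoder (BinningExponent.mapMetric P W) (δ k)) →
            BinningExponent.HasExponent n (fun k => BinningExponent.errorProb P W (δ k)) E) ∧
          ((∀ k, BinningExponent.IsArgmaxDecoder BinningExponent.gmmiMetric (δ k)) →
            BinningExponent.HasExponent n (fun k => BinningExponent.errorProb P W (δ k)) E) ∧
          ((∀ k, BinningExponent.IsArgmaxDecoder (BinningExponent.gmmiMetric' R) (δ k)) →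
            BinningExponent.HasExponent n (fun k => BinningExponent.errorProb P W (δ k)) E) := by
  open BinningExponent in
  obtain ⟨z, hz, hzQ, hmin⟩ := exists_isMinOn_jointObjective hP hW hQ R
  refine ⟨jointObjective P W R z.1 z.2, isLeast_exponentValues hW hQ hz hzQ hmin,
    fun n Qt hn hQt hne δ => ⟨fun hδ => ?_, fun hδ => ?_, fun hδ => ?_⟩⟩
  · obtain ⟨a, -⟩ := exists_lt_margSnd hP.1 hH
    have : Nonempty U := ⟨a.1⟩
    -- MAP has no universal metric of its own: its upper bound is borrowed from some generalized MMI
    -- decoder, which exists because there are finitely many source words.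
    choose δ' hδ' using fun k => exists_isArgmaxDecoder (U := U) (V := V) (X := X) (Y := Y)
      (n := n k) (M := numBins R (n k)) (Q := Qt k) gmmiMetric
    exact hasExponent_errorProb hP hH hW hR.le hz hzQ hmin hn hQt hne δ δ'
      (fun k => errorProb_map_le (hδ k)) (fun k => isUniversalMetric_gmmiMetric R) hδ'
  · exact hasExponent_errorProb hP hH hW hR.le hz hzQ hmin hn hQt hne δ δ (fun k => le_rfl)
      (fun k => isUniversalMetric_gmmiMetric R) hδ
  · exact hasExponent_errorProb hP hH hW hR.le hz hzQ hmin hn hQt hne δ δ (fun k => le_rfl)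
      (fun k => isUniversalMetric_gmmiMetric' R) hδ
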